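/- Definitions. For a finite alphabet $\Gamma$, a relation $J \subseteq \Gamma^*\times\Gamma^*$ is \emph{automatic} if the set of convolutions of its pairs (the two words read in parallel, the shorter one padded at its end with a symbol not in $\Gamma$) is regular, and \emph{bounded} if there is a constant $c$ with $\bigl||y|-|x|\bigr|\le c$ for all $(x,y)\in J$. An \emph{alternating automatic register machine} with input alphabet $\Sigma_0$ consists of a finite register alphabet $\Gamma\supseteq\Sigma_0$ and two finite sets $A$, $B$ of bounded automatic relations on $\Gamma^*$, called instructions. The register initially holds the input $w\in\Sigma_0^*$. Two players, Anke (using $A$) and Boris (using $B$), alternate, Anke moving first; in a turn, the player whose turn it is chooses one of his or her instructions $J$ and a word $x$ with $(r,x)\in J$, where $r$ is the current content of the register, and replaces $r$ by $x$. If no such move exists, the game terminates and the player who cannot move loses. The machine \emph{decides} a language $L\subseteq\Sigma_0^*$ in $f(n)$ steps if for every $n$ and every input $w$ of length $n$: each of the two players can enforce that the game terminates within $f(n)$ turns (the turns of both players being counted); one of the players has a winning strategy needing at most $f(n)$ turns; and $w\in L$ if and only if this player is Anke. $\mathrm{BAAL}[f(n)]$ is the class of languages that some such machine decides in $f(n)$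 steps, $\log^* n$ is the least $k$ such that applying the binary logarithm $k$ times to $n$ gives a value at most $1$, and $\mathrm{BAAL}[\log^* n+O(1)]$ is the union of the classes $\mathrm{BAAL}[\log^* n+c]$ over all constants $c\in\mathbb{N}$. Log-Star Lemma. Let $\Sigma$ be a finite alphabet and let $\#,\$$ be two distinct symbols not in $\Sigma$. Then both languages $$\{u'\$v' : u,v\in\Sigma^*,\ u'\in\#^*u\#^*,\ v'\in\#^*v\#^*,\ u=v\}$$ and $$\{u'\$v' : u,v\in\Sigma^*,\ u'\in\#^*u\#^*,\ v'\in\#^*v\#^*,\ u\ne v\}$$ over the alphabet $\Sigma\cup\{\#,\$\}$ are in $\mathrm{BAAL}[\log^* n+O(1)]$, where $n$ is the length of the input word. -/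

import Mathlib

open scoped Computability

universe u

/-! ### Automatic relations -/

/-- The convolution of two words: they are read in parallel, the shorter one being padded at its
end. The padding symbol is `none`, which is not a letter of the alphabet. -/
def conv {Γ : Type u} (x y : List Γ) : List (Option Γ × Option Γ) :=
  List.zipWithAll Prod.mk x y

/-- A relation `J ⊆ Γ* × Γ*` is automatic if the set of convolutions of its pairs is regular. -/
def IsAutomatic {Γ : Type u} (J : Set (List Γ × List Γ)) : Prop :=
  Language.IsRegular ({z | ∃ p ∈ J, z = conv p.1 p.2} : Language (Option Γ × Option Γ))

/-- A relation is bounded if `||y| - |x|| ≤ c` for all of its pairs `(x, y)`, for a constant `c`. -/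
def IsBoundedRel {Γ : Type u} (J : Set (List Γ × List Γ)) : Prop :=
  ∃ c : ℕ, ∀ p ∈ J, |(p.2.length : ℤ) - (p.1.length : ℤ)| ≤ c

/-! ### Alternating automatic register machines -/

/-- The two players; Anke moves first. -/
inductive Player where
  | anke
  | boris

/-- The opponent of a player. -/
def Player.other : Player → Player
  | .anke => .boris
  | .boris => .anke

/-- The player whose turn it is when `k` turns have been played. -/
def mover (k : ℕ) : Player := if Even k then .anke else .boris

/-- An alternating automatic register machine with input alphabet `α`: a finite register alphabet
`Γ` which contains `α`, and for each player a finite set of instructions (the sets `A` for Anke and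
`B` for Boris), each of which is a bounded automatic relation on words over `Γ`. -/
structure AARM (α : Type u) where
  Γ : Type u
  finite_Γ : Finite Γ
  incl : α ↪ Γ
  instrs : Player → Set (Set (List Γ × List Γ))
  finite_instrs : ∀ p, (instrs p).Finite
  automatic : ∀ p, ∀ J ∈ instrs p, IsAutomatic J
  bounded : ∀ p, ∀ J ∈ instrs p, IsBoundedRel J

/-- A configuration: the instruction executed in a turn, and the contents of the register before
and after it. -/
structure Config (Γ : Type u) where
  instr : Set (List Γ × List Γ)
  before : List Γ
  after : List Γ

/-- A strategy maps the sequence of configurations so far and the current contents of the register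
to an instruction and the new contents of the register. -/
abbrev Strategy (Γ : Type u) : Type u :=
  List (Config Γ) → List Γ → Set (List Γ × List Γ) × List Γ

namespace AARM

variable {α : Type u} (M : AARM α)

/-- Player `p` may, on register contents `r`, execute the instruction `m.1` and thereby change the
contents to `m.2`. -/
def LegalMove (p : Player) (r : List M.Γ) (m : Set (List M.Γ × List M.Γ) × List M.Γ) : Prop :=
  m.1 ∈ M.instrs p ∧ (r, m.2) ∈ m.1

/-- Player `p` can execute some instruction on register contents `r`. -/
def CanMove (p : Player) (r : List M.Γ) : Prop := ∃ m, M.LegalMove p r m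

/-- The strategies of player `p`: they obey the moving rules, that is, they prescribe a legal move
whenever there is one. (Where there is none, the value is never used.) -/
def IsStrategyFor (p : Player) (s : Strategy M.Γ) : Prop :=
  ∀ h r, M.CanMove p r → M.LegalMove p r (s h r)

/-- The contents of the register after the turns in `h`, on input `w`. -/
def contents (w : List α) (h : List (Config M.Γ)) : List M.Γ :=
  match h.getLast? with
  | none => w.map M.incl
  | some c => c.after

/-- `h` is the list of the configurations of the first `h.length` turns of a game on input `w`.
The turn with (0-based) index `i` is played by `mover i`. -/
def IsPlay (w : List α) (h : List (Config M.Γ)) : Prop :=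
  ∀ (i : ℕ) (hi : i < h.length),
    h[i].before = M.contents w (h.take i) ∧
    M.LegalMove (mover i) h[i].before (h[i].instr, h[i].after)

/-- The player who is to move after the turns in `h` cannot execute any instruction, so that the
game terminates. -/
def IsOver (w : List α) (h : List (Config M.Γ)) : Prop :=
  ¬ M.CanMove (mover h.length) (M.contents w h)

/-- All turns of player `p` in `h` are played according to the strategy `s`. -/
def Follows (p : Player) (s : Strategy M.Γ) (h : List (Config M.Γ)) : Prop :=
  ∀ (i : ℕ) (hi : i < h.length), mover i = p →
    s (h.take i) h[i].before = (h[i].instr, h[i].after)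

/-- `h` is the whole, finite computation history on input `w` in which player `p` uses the strategy
`s` and the opponent uses the strategy `s'`. -/
def IsHistory (w : List α) (p : Player) (s s' : Strategy M.Γ) (h : List (Config M.Γ)) : Prop :=
  M.IsPlay w h ∧ M.IsOver w h ∧ M.Follows p s h ∧ M.Follows p.other s' h

/-- Player `p` can enforce that the game on input `w` terminates within `t` turns. -/
def ForcesEnd (w : List α) (p : Player) (t : ℕ) : Prop :=
  ∃ s, M.IsStrategyFor p s ∧ ∀ s', M.IsStrategyFor p.other s' →
    ∃ h, M.IsHistory w p s s' h ∧ h.length ≤ t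

/-- Player `p` has a winning strategy for the game on input `w` which needs at most `t` turns:
whatever the opponent does, within `t` turns it is the opponent who cannot move. -/
def WinsWithin (w : List α) (p : Player) (t : ℕ) : Prop :=
  ∃ s, M.IsStrategyFor p s ∧ ∀ s', M.IsStrategyFor p.other s' →
    ∃ h, M.IsHistory w p s s' h ∧ mover h.length = p.other ∧ h.length ≤ t

/-- `M` decides the language `L` in `f n` steps, where `n` is the length of the input: on every
input both players can enforce that the game terminates within `f n` turns, one of them has a
winning strategy needing at most `f n` turns, and the input is in `L` iff that player is Anke. -/
def Decides (L : Language α) (f : ℕ → ℕ) : Prop :=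
  ∀ w : List α,
    (∀ p, M.ForcesEnd w p (f w.length)) ∧
    ∃ p, M.WinsWithin w p (f w.length) ∧ (w ∈ L ↔ p = .anke)

end AARM

/-- The class `BAAL[f(n)]` of languages (over the alphabet `α`) that are decided in `f(n)` steps by
an alternating automatic register machine. -/
def BAAL (α : Type u) (f : ℕ → ℕ) : Set (Language α) :=
  {L | ∃ M : AARM α, M.Decides L f}

/-- The iterated logarithm: the least number of times that the binary logarithm has to be applied
to `n` to reach a value which is at most `1`. -/
noncomputable def logStar (n : ℕ) : ℕ :=
  sInf {k : ℕ | (Real.logb 2)^[k] (n : ℝ) ≤ 1}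

/-- The class `BAAL[log* n + O(1)]`. -/
def BAALLogStar (α : Type u) : Set (Language α) :=
  {L | ∃ c : ℕ, L ∈ BAAL α (fun n => logStar n + c)}

/-! ### Comparison languages -/

/-- The alphabet `Σ ∪ {#, $}`, where `#` and `$` are two distinct symbols not in `Σ`. -/
inductive PadSym (α : Type u) where
  | letter (a : α)
  | hash
  | dollar

/-- The language `#* u #*`. -/
def padded {α : Type u} (u : List α) : Language (PadSym α) :=
  ({[PadSym.hash]} : Language (PadSym α))∗ * {u.map PadSym.letter} *
    ({[PadSym.hash]} : Language (PadSym α))∗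

/-- The language of all `u' $ v'` with `u' ∈ #* u #*`, `v' ∈ #* v #*` and `u = v`. -/
def eqLanguage (α : Type u) : Language (PadSym α) :=
  {w | ∃ u v : List α, ∃ u' ∈ padded u, ∃ v' ∈ padded v,
    w = u' ++ [PadSym.dollar] ++ v' ∧ u = v}

/-- The language of all `u' $ v'` with `u' ∈ #* u #*`, `v' ∈ #* v #*` and `u ≠ v`. -/
def neLanguage (α : Type u) : Language (PadSym α) :=
  {w | ∃ u v : List α, ∃ u' ∈ padded u, ∃ v' ∈ padded v,
    w = u' ++ [PadSym.dollar] ++ v' ∧ u ≠ v}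

/-! Both games reduce to deciding whether two factors of the register have equal length. A player
who claims this overwrites them with labels, ideally initial segments of the stream of all binary
words in length-lexicographic order, each preceded by a separator. Objections to the labels are
again claims that two factors have equal length: two prefixes of blocks, followed by letters that
would not fit together if the prefixes were equally long.

If equal factors carry the same honest labels, every such objection is false (`Dispute.of_isCount`).
If the factors differ in length, then, however they are labelled, some objection is true
(`exists_dispute`). In both cases the disputed prefixes are logarithmically short, since block
number `n` of the stream has logarithmic length. So a true claim with honest labels is answered by a
false claim, a false claim can be answered by a true one with honest labels, and each turn removes
one exponential. Factors of length at most 1 are compared by the instruction itself. By induction a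
claim about lengths up to `tower k` is settled in `k + 2` turns (`forces_frame`).

Two words differ iff prefixes of equal length are followed by different letters, or by a letter and
an end. Hence denying equality of the input words is one such claim: Boris makes it after Anke has
confirmed the format, or Anke makes it at once. This costs at most two more turns.

The instructions are automatic because they preserve length and treat boundedly many regular factors
independently. Resignation lets each player end the game whoever deserves to win. -/

/-! ### Closure properties of regular languages -/

namespace Language

variable {T S : Type u}

/-- Myhill–Nerode: the left quotient by `x` is determined by a left quotient of `L₁` together with
the set of left quotients of `L₂` arising from the splittings of `x` whose first part is in `L₁`.
There are finitely many such pairs. -/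
theorem IsRegular.mul {L₁ L₂ : Language T} (h₁ : L₁.IsRegular) (h₂ : L₂.IsRegular) :
    (L₁ * L₂).IsRegular := by
  apply IsRegular.of_finite_range_leftQuotient
  refine ((h₁.finite_range_leftQuotient.prod
    h₂.finite_range_leftQuotient.finite_subsets).image
      fun X : Language T × Set (Language T) =>
        X.1 * L₂ + ⨆ B : X.2, (B : Language T)).subset ?_
  rintro _ ⟨x, rfl⟩
  refine ⟨(L₁.leftQuotient x,
    {B | ∃ a b, a ++ b = x ∧ a ∈ L₁ ∧ B = L₂.leftQuotient b}), ⟨⟨x, rfl⟩, ?_⟩, ?_⟩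
  · rintro _ ⟨a, b, -, -, rfl⟩
    exact ⟨b, rfl⟩
  · ext y
    rw [mem_add, mem_leftQuotient, mem_mul, mem_mul, mem_iSup]
    constructor
    · rintro (⟨a, ha, b, hb, rfl⟩ | ⟨⟨_, a, b, rfl, ha, rfl⟩, hy⟩)
      · exact ⟨x ++ a, ha, b, hb, by simp⟩
      · exact ⟨a, ha, b ++ y, hy, by simp⟩
    · rintro ⟨a, ha, b, hb, h⟩
      rcases List.append_eq_append_iff.1 h with ⟨c, rfl, rfl⟩ | ⟨c, rfl, rfl⟩
      · exact Or.inr ⟨⟨_, a, c, rfl, ha, rfl⟩, hb⟩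
      · exact Or.inl ⟨c, ha, b, hb, rfl⟩

theorem IsRegular.preimage_map {L : Language S} (h : L.IsRegular) (f : T → S) :
    IsRegular ({x | x.map f ∈ L} : Language T) := by
  obtain ⟨σ, _, M, rfl⟩ := h
  exact ⟨σ, inferInstance, M.comap f, M.accepts_comap f⟩

theorem mem_map {f : T → S} {L : Language T} {x : List S} :
    x ∈ map f L ↔ ∃ y ∈ L, y.map f = x := Iff.rfl

/-- By injectivity the left quotient by an image word is the image of a left quotient; by any other
word it is empty. -/
theorem IsRegular.map_of_injective {L : Language T} (h : L.IsRegular) {f : T → S}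
    (hf : Function.Injective f) : (map f L).IsRegular := by
  apply IsRegular.of_finite_range_leftQuotient
  refine ((h.finite_range_leftQuotient.image (map f)).union
    (Set.finite_singleton (0 : Language S))).subset ?_
  rintro _ ⟨x, rfl⟩
  by_cases hx : ∃ x', x = List.map f x'
  · obtain ⟨x, rfl⟩ := hx
    refine Or.inl ⟨L.leftQuotient x, ⟨x, rfl⟩, ?_⟩
    ext y
    rw [mem_leftQuotient, mem_map, mem_map]
    constructor
    · rintro ⟨y, hy, rfl⟩
      exact ⟨x ++ y, hy, by simp⟩
    · rintro ⟨z, hz, h⟩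
      obtain ⟨a, b, rfl, ha, rfl⟩ := List.map_eq_append_iff.1 h
      obtain rfl := List.map_injective_iff.2 hf ha
      exact ⟨b, hz, rfl⟩
  · refine Or.inr (Set.mem_singleton_iff.2 (Language.ext fun y => ?_))
    refine iff_of_false ?_ (notMem_zero y)
    rintro ⟨z, hz, h⟩
    obtain ⟨a, b, rfl, ha, rfl⟩ := List.map_eq_append_iff.1 h
    exact hx ⟨a, ha.symm⟩

/-- The words all of whose letters satisfy `p`. -/
def allL (p : T → Prop) : Language T := {w | ∀ a ∈ w, p a}

/-- The words that consist of one letter, which satisfies `p`. -/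
def oneL (p : T → Prop) : Language T := {w | ∃ a, p a ∧ w = [a]}

theorem mem_allL {p : T → Prop} {w : List T} : w ∈ allL p ↔ ∀ a ∈ w, p a := Iff.rfl

theorem mem_oneL {p : T → Prop} {w : List T} : w ∈ oneL p ↔ ∃ a, p a ∧ w = [a] := Iff.rfl

theorem isRegular_allL (p : T → Prop) : (allL p).IsRegular := by
  apply IsRegular.of_finite_range_leftQuotient
  refine (Set.toFinite {allL p, 0}).subset ?_
  rintro _ ⟨x, rfl⟩
  by_cases hx : ∀ a ∈ x, p a
  · refine Or.inl ?_
    ext y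
    rw [mem_leftQuotient, mem_allL, mem_allL]
    simp only [List.mem_append]
    exact ⟨fun h a ha => h a (Or.inr ha), fun h a ha => ha.elim (hx a) (h a)⟩
  · refine Or.inr ?_
    rw [Set.mem_singleton_iff]
    ext y
    refine iff_of_false (fun h => hx fun a ha => ?_) (notMem_zero y)
    exact h a (List.mem_append_left _ ha)

theorem isRegular_one : (1 : Language T).IsRegular := by
  convert isRegular_allL (fun _ : T => False) using 1
  ext x
  rw [mem_one, mem_allL]
  exact List.eq_nil_iff_forall_not_mem

theorem isRegular_oneL (p : T → Prop) : (oneL p).IsRegular := by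
  apply IsRegular.of_finite_range_leftQuotient
  refine (Set.toFinite {oneL p, 1, 0}).subset ?_
  rintro _ ⟨x, rfl⟩
  rcases x with _ | ⟨a, _ | ⟨b, x⟩⟩
  · exact Or.inl rfl
  · by_cases ha : p a
    · refine Or.inr (Or.inl ?_)
      ext y
      rw [mem_leftQuotient, mem_oneL, mem_one]
      simp [ha]
    · refine Or.inr (Or.inr ?_)
      rw [Set.mem_singleton_iff]
      ext y
      refine iff_of_false ?_ (notMem_zero y)
      rintro ⟨c, hc, h⟩
      simp only [List.cons_append, List.nil_append, List.cons.injEq] at h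
      exact ha (h.1 ▸ hc)
  · refine Or.inr (Or.inr ?_)
    rw [Set.mem_singleton_iff]
    ext y
    refine iff_of_false ?_ (notMem_zero y)
    rintro ⟨c, hc, h⟩
    simp at h

/-- The words of length `k`. -/
def lenL (T : Type u) : ℕ → Language T
  | 0 => 1
  | k + 1 => oneL (fun _ => True) * lenL T k

theorem mem_lenL {k : ℕ} {w : List T} : w ∈ lenL T k ↔ w.length = k := by
  induction k generalizing w with
  | zero => rw [lenL, mem_one, List.length_eq_zero_iff]
  | succ k ih =>
    rw [lenL, mem_mul]
    constructor
    · rintro ⟨_, ⟨a, -, rfl⟩, b, hb, rfl⟩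
      simp [ih.1 hb]
    · intro h
      obtain ⟨a, w, rfl⟩ := List.exists_cons_of_length_eq_add_one h
      exact ⟨[a], ⟨a, trivial, rfl⟩, w, ih.2 (by simpa using h), rfl⟩

theorem isRegular_lenL (k : ℕ) : (lenL T k).IsRegular := by
  induction k with
  | zero => exact isRegular_one
  | succ k ih => exact (isRegular_oneL _).mul ih

end Language

/-! ### Length-preserving automatic relations -/

open Language

/-- The pairs of words of equal length that, read in parallel, form a word of a regular language. -/
def IsSyncRegular {T : Type u} (R : Set (List T × List T)) : Prop :=
  ∃ Z : Language (T × T), Z.IsRegular ∧ R = {p | ∃ z ∈ Z, p = (z.map Prod.fst, z.map Prod.snd)}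

/-- The pairs of words that are concatenations of a pair in `R` and a pair in `S`. -/
def relMul {T : Type u} (R S : Set (List T × List T)) : Set (List T × List T) :=
  {p | ∃ a ∈ R, ∃ b ∈ S, p = (a.1 ++ b.1, a.2 ++ b.2)}

/-- The pairs of words of equal length with components in `L` and in `K`. -/
def relBox {T : Type u} (L K : Language T) : Set (List T × List T) :=
  {p | p.1 ∈ L ∧ p.2 ∈ K ∧ p.1.length = p.2.length}

namespace IsSyncRegular

variable {T : Type u} {R S : Set (List T × List T)}

theorem mul (hR : IsSyncRegular R) (hS : IsSyncRegular S) : IsSyncRegular (relMul R S) := by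
  obtain ⟨Z, hZ, rfl⟩ := hR
  obtain ⟨Y, hY, rfl⟩ := hS
  refine ⟨Z * Y, hZ.mul hY, ?_⟩
  ext p
  constructor
  · rintro ⟨_, ⟨z, hz, rfl⟩, _, ⟨y, hy, rfl⟩, rfl⟩
    exact ⟨z ++ y, append_mem_mul hz hy, by simp⟩
  · rintro ⟨_, ⟨z, hz, y, hy, rfl⟩, rfl⟩
    exact ⟨_, ⟨z, hz, rfl⟩, _, ⟨y, hy, rfl⟩, by simp⟩

theorem box {L K : Language T} (hL : L.IsRegular) (hK : K.IsRegular) :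
    IsSyncRegular (relBox L K) := by
  refine ⟨_, (hL.preimage_map Prod.fst).inf (hK.preimage_map Prod.snd), ?_⟩
  ext ⟨x, y⟩
  constructor
  · rintro ⟨hx, hy, h⟩
    have h1 : (x.zip y).map Prod.fst = x := List.map_fst_zip h.le
    have h2 : (x.zip y).map Prod.snd = y := List.map_snd_zip h.ge
    refine ⟨x.zip y, ⟨?_, ?_⟩, by rw [h1, h2]⟩
    · change (x.zip y).map Prod.fst ∈ L
      rwa [h1]
    · change (x.zip y).map Prod.snd ∈ K
      rwa [h2]
  · rintro ⟨z, ⟨h1, h2⟩, h⟩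
    obtain ⟨rfl, rfl⟩ := Prod.ext_iff.1 h
    exact ⟨h1, h2, by simp⟩

theorem diag {L : Language T} (hL : L.IsRegular) :
    IsSyncRegular {p : List T × List T | p.1 ∈ L ∧ p.1 = p.2} := by
  refine ⟨_, (hL.preimage_map Prod.fst).inf (isRegular_allL fun a : T × T => a.1 = a.2), ?_⟩
  ext ⟨x, y⟩
  constructor
  · rintro ⟨hx, rfl : x = y⟩
    refine ⟨x.map fun a => (a, a), ⟨?_, ?_⟩, by simp [Function.comp_def]⟩
    · change (x.map fun a => (a, a)).map Prod.fst ∈ L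
      simpa [Function.comp_def] using hx
    · intro a ha
      obtain ⟨b, -, rfl⟩ := List.mem_map.1 ha
      rfl
  · rintro ⟨z, ⟨h1, h2⟩, h⟩
    obtain ⟨rfl, rfl⟩ := Prod.ext_iff.1 h
    exact ⟨h1, List.map_congr_left h2⟩

theorem conv_map_fst_map_snd (z : List (T × T)) :
    conv (z.map Prod.fst) (z.map Prod.snd) = z.map (Prod.map some some) := by
  induction z with
  | nil => rfl
  | cons a z ih => simpa [conv, Prod.map] using ih

/-- Words of equal length need no padding, so the convolutions are the image of `Z` under an
injective map of letters. -/
theorem isAutomatic (hR : IsSyncRegular R) : IsAutomatic R := by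
  obtain ⟨Z, hZ, rfl⟩ := hR
  have h := hZ.map_of_injective (f := Prod.map some some)
    (Function.Injective.prodMap (Option.some_injective T) (Option.some_injective T))
  refine Eq.subst (motive := Language.IsRegular) (Language.ext fun x => ?_) h
  constructor
  · rintro ⟨z, hz, rfl⟩
    exact ⟨_, ⟨z, hz, rfl⟩, (conv_map_fst_map_snd z).symm⟩
  · rintro ⟨_, ⟨z, hz, rfl⟩, rfl⟩
    exact ⟨z, hz, (conv_map_fst_map_snd z).symm⟩

theorem isBoundedRel (hR : IsSyncRegular R) : IsBoundedRel R := by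
  obtain ⟨Z, hZ, rfl⟩ := hR
  refine ⟨0, ?_⟩
  rintro _ ⟨z, -, rfl⟩
  simp

end IsSyncRegular

/-! ### Games with a bounded number of turns -/

theorem Player.other_other (p : Player) : p.other.other = p := by cases p <;> rfl

theorem Player.other_ne (p : Player) : p.other ≠ p := by
  cases p <;> simp [Player.other]

theorem mover_succ (k : ℕ) : mover (k + 1) = (mover k).other := by
  unfold mover
  by_cases h : Even k
  · simp [h, Nat.even_add_one, Player.other]
  · simp [h, Nat.even_add_one, Player.other]

namespace AARM

variable {α : Type u} (M : AARM α)

/-- Player `p` can enforce that, when player `q` is to move on register contents `r`, the game ends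
within `t` turns and a player with the property `G` is the one who cannot move. -/
def Forces (p : Player) (G : Player → Prop) : ℕ → Player → List M.Γ → Prop
  | 0, q, r => G q ∧ ¬ M.CanMove q r
  | t + 1, q, r => (G q ∧ ¬ M.CanMove q r) ∨
      (q = p ∧ ∃ m, M.LegalMove q r m ∧ Forces p G t q.other m.2) ∨
      (q = p.other ∧ M.CanMove q r ∧ ∀ m, M.LegalMove q r m → Forces p G t q.other m.2)

variable {M}

theorem Forces.of_stuck {p : Player} {G : Player → Prop} {q : Player} {r : List M.Γ} (hG : G q)
    (hr : ¬ M.CanMove q r) (t : ℕ) : M.Forces p G t q r := by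
  cases t with
  | zero => exact ⟨hG, hr⟩
  | succ t => exact Or.inl ⟨hG, hr⟩

theorem Forces.of_move {p : Player} {G : Player → Prop} {r : List M.Γ} {t : ℕ}
    {J : Set (List M.Γ × List M.Γ)} {x : List M.Γ} (hJ : J ∈ M.instrs p) (hx : (r, x) ∈ J)
    (h : M.Forces p G t p.other x) : M.Forces p G (t + 1) p r :=
  Or.inr (Or.inl ⟨rfl, (J, x), ⟨hJ, hx⟩, h⟩)

theorem Forces.of_forall {p : Player} {G : Player → Prop} {r : List M.Γ} {t : ℕ}
    (hG : G p.other) (h : ∀ J ∈ M.instrs p.other, ∀ x, (r, x) ∈ J → M.Forces p G t p x) :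
    M.Forces p G (t + 1) p.other r := by
  by_cases hc : M.CanMove p.other r
  · refine Or.inr (Or.inr ⟨rfl, hc, fun m hm => ?_⟩)
    rw [Player.other_other]
    exact h m.1 hm.1 m.2 hm.2
  · exact Or.inl ⟨hG, hc⟩

theorem Forces.succ {p : Player} {G : Player → Prop} {q : Player} {r : List M.Γ} {t : ℕ}
    (h : M.Forces p G t q r) : M.Forces p G (t + 1) q r := by
  induction t generalizing q r with
  | zero => exact Or.inl h
  | succ t ih =>
    rcases h with h | ⟨hq, m, hm, h⟩ | ⟨hq, hc, h⟩
    · exact Or.inl h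
    · exact Or.inr (Or.inl ⟨hq, m, hm, ih h⟩)
    · exact Or.inr (Or.inr ⟨hq, hc, fun m hm => ih (h m hm)⟩)

theorem Forces.mono {p : Player} {G : Player → Prop} {q : Player} {r : List M.Γ} {t t' : ℕ}
    (h : M.Forces p G t q r) (ht : t ≤ t') : M.Forces p G t' q r := by
  induction ht with
  | refl => exact h
  | step _ ih => exact ih.succ

/-! ### From the game-tree predicate to strategies. -/

theorem contents_concat (w : List α) (h : List (Config M.Γ)) (c : Config M.Γ) :
    M.contents w (h ++ [c]) = c.after := by
  simp [contents]

theorem IsPlay.concat {w : List α} {h : List (Config M.Γ)} (hp : M.IsPlay w h)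
    {m : Set (List M.Γ × List M.Γ) × List M.Γ}
    (hm : M.LegalMove (mover h.length) (M.contents w h) m) :
    M.IsPlay w (h ++ [⟨m.1, M.contents w h, m.2⟩]) := by
  intro i hi
  rw [List.length_append, List.length_singleton] at hi
  rcases Nat.lt_succ_iff_lt_or_eq.1 hi with hi | rfl
  · rw [List.getElem_append_left hi, List.take_append_of_le_length hi.le]
    exact hp i hi
  · simpa using hm

theorem Follows.concat {p : Player} {s : Strategy M.Γ} {h : List (Config M.Γ)}
    (hf : M.Follows p s h) {c : Config M.Γ}
    (hc : mover h.length = p → s h c.before = (c.instr, c.after)) :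
    M.Follows p s (h ++ [c]) := by
  intro i hi
  rw [List.length_append, List.length_singleton] at hi
  rcases Nat.lt_succ_iff_lt_or_eq.1 hi with hi | rfl
  · rw [List.getElem_append_left hi, List.take_append_of_le_length hi.le]
    exact hf i hi
  · simpa using hc

open Classical in
/-- The strategy of `p` that, among the first `T` turns, keeps the property `Forces` true. -/
noncomputable def forcingStrategy (M : AARM α) (p : Player) (G : Player → Prop) (T : ℕ) :
    Strategy M.Γ := fun h r =>
  if hm : ∃ m, M.LegalMove p r m ∧ M.Forces p G (T - h.length - 1) p.other m.2 then hm.choose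
  else if hm : M.CanMove p r then hm.choose else (∅, [])

theorem isStrategyFor_forcingStrategy (p : Player) (G : Player → Prop) (T : ℕ) :
    M.IsStrategyFor p (M.forcingStrategy p G T) := by
  intro h r hr
  unfold forcingStrategy
  split_ifs with hm
  · exact hm.choose_spec.1
  · exact hr.choose_spec

theorem Forces.exists_history_extending {p : Player} {G : Player → Prop} {T : ℕ} {w : List α}
    {s' : Strategy M.Γ} (hs' : M.IsStrategyFor p.other s') {t : ℕ} {h : List (Config M.Γ)}
    (hp : M.IsPlay w h) (hf : M.Follows p (M.forcingStrategy p G T) h)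
    (hf' : M.Follows p.other s' h) (ht : h.length + t = T)
    (hF : M.Forces p G t (mover h.length) (M.contents w h)) :
    ∃ h, M.IsHistory w p (M.forcingStrategy p G T) s' h ∧ G (mover h.length) ∧ h.length ≤ T := by
  induction t generalizing h with
  | zero => exact ⟨h, ⟨hp, hF.2, hf, hf'⟩, hF.1, by omega⟩
  | succ t ih =>
    rcases hF with hF | ⟨hq, m, hm, hF⟩ | ⟨hq, hc, hF⟩
    · exact ⟨h, ⟨hp, hF.2, hf, hf'⟩, hF.1, by omega⟩
    -- The strategy computes the remaining turns from the history; this matches them with the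
    -- induction variable.
    · have hT : T - h.length - 1 = t := by omega
      rw [hq] at hm hF
      have hex : ∃ m, M.LegalMove p (M.contents w h) m ∧
          M.Forces p G (T - h.length - 1) p.other m.2 := ⟨m, hm, by rwa [hT]⟩
      have hs : M.forcingStrategy p G T h (M.contents w h) = hex.choose := by
        unfold forcingStrategy
        rw [dif_pos hex]
      have hspec := hex.choose_spec
      refine ih (hp.concat (m := hex.choose) (by rw [hq]; exact hspec.1))
        (hf.concat fun _ => hs) (hf'.concat fun h' => ?_) ?_ ?_
      · exact absurd (h'.symm.trans hq) p.other_ne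
      · simp only [List.length_append, List.length_singleton]
        omega
      · rw [contents_concat, List.length_append, List.length_singleton, mover_succ, hq, ← hT]
        exact hspec.2
    · have hl := hs' h (M.contents w h) (by rwa [← hq])
      refine ih (hp.concat (m := s' h (M.contents w h)) (by rwa [hq]))
        (hf.concat fun h' => ?_) (hf'.concat fun _ => rfl) ?_ ?_
      · exact absurd (hq.symm.trans h') p.other_ne
      · simp only [List.length_append, List.length_singleton]
        omega
      · rw [contents_concat, List.length_append, List.length_singleton, mover_succ]
        exact hF _ (by rwa [hq])

/-- Used with two choices of `G`: the trivial one yields `ForcesEnd`, being the opponent yields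
`WinsWithin`. -/
theorem Forces.exists_strategy {p : Player} {G : Player → Prop} {T : ℕ} {w : List α}
    (hF : M.Forces p G T .anke (w.map M.incl)) :
    ∃ s, M.IsStrategyFor p s ∧ ∀ s', M.IsStrategyFor p.other s' →
      ∃ h, M.IsHistory w p s s' h ∧ G (mover h.length) ∧ h.length ≤ T :=
  ⟨_, isStrategyFor_forcingStrategy p G T, fun _ hs' =>
    Forces.exists_history_extending hs' (t := T) (h := []) (fun _ hi => absurd hi (Nat.not_lt_zero _))
      (fun _ hi => absurd hi (Nat.not_lt_zero _)) (fun _ hi => absurd hi (Nat.not_lt_zero _))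
      (by simp) (by simpa [mover, contents] using hF)⟩

theorem Forces.forcesEnd {p : Player} {T : ℕ} {w : List α}
    (hF : M.Forces p (fun _ => True) T .anke (w.map M.incl)) : M.ForcesEnd w p T := by
  obtain ⟨s, hs, h⟩ := hF.exists_strategy
  refine ⟨s, hs, fun s' hs' => ?_⟩
  obtain ⟨h, h1, -, h2⟩ := h s' hs'
  exact ⟨h, h1, h2⟩

theorem Forces.winsWithin {p : Player} {T : ℕ} {w : List α}
    (hF : M.Forces p (· = p.other) T .anke (w.map M.incl)) : M.WinsWithin w p T :=
  hF.exists_strategy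

end AARM

/-! ### Binary counters -/

/-- The successor of a binary word (least significant digit first) in the length-lexicographic
enumeration of all binary words. -/
def inc : List Bool → List Bool
  | [] => [false]
  | false :: w => true :: w
  | true :: w => false :: inc w

/-- The position of a binary word in the length-lexicographic enumeration. -/
def rank : List Bool → ℕ
  | [] => 0
  | b :: w => b.toNat + 1 + 2 * rank w

/-- `rank` is bijective base two with digit values 1 and 2: a carry turns a 2 into a 1 and adds one
to the rest. -/
theorem rank_inc (w : List Bool) : rank (inc w) = rank w + 1 := by
  induction w with
  | nil => rfl
  | cons b w ih =>
    cases b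
    · simp only [inc, rank, Bool.toNat_false, Bool.toNat_true]
      omega
    · simp only [inc, rank, Bool.toNat_false, Bool.toNat_true, ih]
      omega

theorem two_pow_length_le (w : List Bool) : 2 ^ w.length ≤ rank w + 1 := by
  induction w with
  | nil => simp [rank]
  | cons b w ih =>
    rw [List.length_cons, pow_succ, rank]
    omega

/-- The `n`-th binary word. -/
def counter : ℕ → List Bool
  | 0 => []
  | n + 1 => inc (counter n)

theorem rank_counter (n : ℕ) : rank (counter n) = n := by
  induction n with
  | zero => rfl
  | succ n ih => rw [counter, rank_inc, ih]

theorem counter_injective : Function.Injective counter := fun a b h => by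
  rw [← rank_counter a, h, rank_counter]

theorem two_pow_length_counter_le (n : ℕ) : 2 ^ (counter n).length ≤ n + 1 :=
  (two_pow_length_le _).trans_eq (by rw [rank_counter])

/-- The source of all logarithmic bounds: a prefix of counter number `n` is exponentially shorter
than any word containing the earlier blocks. -/
theorem two_pow_le_of_length_le {n p m : ℕ} (hp : p ≤ (counter n).length) (hn : n + 1 ≤ m) :
    2 ^ p ≤ m :=
  ((Nat.pow_le_pow_right two_pos hp).trans (two_pow_length_counter_le n)).trans hn

/-- The carry runs through all of `P`. -/
theorem inc_append_of_forall {P : List Bool} (hP : ∀ x ∈ P, x = true) (b : List Bool) :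
    inc (P ++ b) = List.replicate P.length false ++ inc b := by
  induction P with
  | nil => rfl
  | cons x P ih =>
    rw [List.forall_mem_cons] at hP
    rw [hP.1, List.cons_append, inc, ih hP.2]
    rfl

/-- The carry is absorbed inside `P`, so the digits behind it are copied. -/
theorem inc_append_of_mem {P : List Bool} (hP : false ∈ P) (b : List Bool) :
    ∃ P', P'.length = P.length ∧ inc (P ++ b) = P' ++ b := by
  induction P with
  | nil => simp at hP
  | cons x P ih =>
    cases x
    · exact ⟨true :: P, rfl, rfl⟩
    · obtain ⟨P', h1, h2⟩ := ih (by simpa using hP)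
      exact ⟨false :: P', by simp [h1], by rw [List.cons_append, inc, h2]; rfl⟩

/-! ### Streams of counters

Words over `Option Bool` are read as sequences of binary words, each one preceded by the separator
`none`. -/

/-- The binary words number `j`, …, `j + n - 1`, each one preceded by a separator. -/
def counterStream : ℕ → ℕ → List (Option Bool)
  | _, 0 => []
  | j, n + 1 => none :: ((counter j).map some ++ counterStream (j + 1) n)

theorem le_length_counterStream (j n : ℕ) : n ≤ (counterStream j n).length := by
  induction n generalizing j with
  | zero => exact Nat.zero_le _
  | succ n ih =>
    have := ih (j + 1)
    simp only [counterStream, List.length_cons, List.length_append]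
    omega

theorem counterStream_succ (j n : ℕ) :
    counterStream j (n + 1) = counterStream j n ++ none :: (counter (j + n)).map some := by
  induction n generalizing j with
  | zero => simp [counterStream]
  | succ n ih =>
    rw [counterStream, ih, counterStream, Nat.add_right_comm j 1 n, Nat.add_assoc j n 1]
    simp

theorem exists_counterStream_of_cons_prefix {x : Option Bool} {β : List (Option Bool)} {j n : ℕ}
    (h : x :: β <+: counterStream j n) :
    x = none ∧ ∃ n', n = n' + 1 ∧ β <+: (counter j).map some ++ counterStream (j + 1) n' := by
  cases n with
  | zero => simp [counterStream] at h
  | succ n =>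
    rw [counterStream, List.cons_prefix_cons] at h
    exact ⟨h.1, n, rfl, h.2⟩

theorem prefix_of_append_none_prefix {c : List Bool} {u β S : List (Option Bool)}
    (h : u ++ none :: β <+: c.map some ++ S) :
    ∃ v, u = c.map some ++ v ∧ v ++ none :: β <+: S := by
  induction c generalizing u with
  | nil => exact ⟨u, rfl, h⟩
  | cons x c ih =>
    cases u with
    | nil => simp at h
    | cons y u =>
      rw [List.map_cons, List.cons_append, List.cons_append, List.cons_prefix_cons] at h
      obtain ⟨v, rfl, hv⟩ := ih h.2
      exact ⟨v, by simp [h.1], hv⟩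

theorem count_none_map_some (c : List Bool) : (c.map some).count none = 0 := by
  simp [List.count_eq_zero]

/-- The number of separators before a position tells which counter stands there. -/
theorem none_cons_prefix_counterStream {α β : List (Option Bool)} {j n : ℕ}
    (h : α ++ none :: β <+: counterStream j n) :
    ∃ n', β <+: (counter (j + α.count none)).map some ++
      counterStream (j + α.count none + 1) n' := by
  induction n generalizing α j with
  | zero => simp [counterStream] at h
  | succ n ih =>
    cases α with
    | nil =>
      obtain ⟨-, n', -, h⟩ := exists_counterStream_of_cons_prefix h
      exact ⟨n', h⟩
    | cons a α =>
      obtain ⟨rfl, n', hn, h⟩ := exists_counterStream_of_cons_prefix h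
      obtain rfl := Nat.succ_injective hn
      obtain ⟨v, rfl, hv⟩ := prefix_of_append_none_prefix h
      obtain ⟨n', h'⟩ := ih hv
      have hc : (none :: ((counter j).map some ++ v)).count none = v.count none + 1 := by
        rw [List.count_cons_self, List.count_append, count_none_map_some, zero_add]
      rw [hc, ← Nat.add_assoc, Nat.add_right_comm j]
      exact ⟨n', h'⟩

theorem prefix_of_map_some_prefix {b c : List Bool} {j n : ℕ}
    (h : b.map some <+: c.map some ++ counterStream j n) : b <+: c := by
  induction c generalizing b with
  | nil =>
    cases b with
    | nil => exact List.nil_prefix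
    | cons x b => simpa using (exists_counterStream_of_cons_prefix h).1
  | cons y c ih =>
    cases b with
    | nil => exact List.nil_prefix
    | cons x b =>
      rw [List.map_cons, List.map_cons, List.cons_append, List.cons_prefix_cons] at h
      rw [List.cons_prefix_cons]
      exact ⟨Option.some_injective _ h.1, ih h.2⟩

/-- The initial segments of the stream of all counters. -/
def IsCount (s : List (Option Bool)) : Prop := ∃ n, s <+: counterStream 0 n

theorem IsCount.block {α β : List (Option Bool)} {b : List Bool}
    (h : IsCount (α ++ none :: (b.map some ++ β))) : b <+: counter (α.count none) := by
  obtain ⟨n, h⟩ := h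
  obtain ⟨n', h'⟩ := none_cons_prefix_counterStream h
  rw [zero_add] at h'
  exact prefix_of_map_some_prefix ((List.prefix_append _ _).trans h')

theorem IsCount.next_block {α ρ : List (Option Bool)} {b : List Bool}
    (h : IsCount (α ++ none :: (b.map some ++ none :: ρ))) :
    ∃ n, ρ <+: (inc b).map some ++ counterStream (α.count none + 2) n := by
  have hb := h.block
  obtain ⟨n, h⟩ := h
  obtain ⟨n', h'⟩ := none_cons_prefix_counterStream h
  rw [zero_add] at h'
  obtain ⟨v, hv, h''⟩ := prefix_of_append_none_prefix h'
  -- The separator after `b` shows that no digit of the counter is missing.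
  have hbc : b = counter (α.count none) := by
    refine hb.eq_of_length_le ?_
    have := congrArg List.length hv
    simp only [List.length_append, List.length_map] at this
    omega
  have hv : v = [] := by
    have := congrArg List.length hv
    rw [hbc] at this
    simp only [List.length_append, List.length_map] at this
    exact List.length_eq_zero_iff.1 (by omega)
  subst hv
  obtain ⟨-, n'', -, h⟩ := exists_counterStream_of_cons_prefix h''
  rw [hbc]
  exact ⟨n'', h⟩

/-- Counter 0 is the empty word, so the stream opens with two separators. This opening is a regular
condition, and it anchors labels that may otherwise be arbitrary. -/
theorem IsCount.exists_of_length {m : ℕ} (hm : 2 ≤ m) :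
    ∃ s, IsCount s ∧ s.length = m ∧ ∃ t, s = none :: none :: t := by
  obtain ⟨m, rfl⟩ := Nat.exists_eq_add_of_le' hm
  refine ⟨(counterStream 0 (m + 2)).take (m + 2), ⟨m + 2, List.take_prefix _ _⟩, ?_, ?_⟩
  · rw [List.length_take, min_eq_left (le_length_counterStream _ _)]
  · simp [counterStream, counter]

/-! ### Local inconsistencies of sequences of counters -/

/-- The first letter of `inc b ++ [none]`, given the first letter of `b ++ [none]`. -/
def carryDigit : Option Bool → Option Bool
  | none => some false
  | some b => some !b

/-- After the block `b` and a separator, `ρ` cannot continue a sequence of counters. An instance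
with parameters `p` and `q` witnesses this when `p = q`. -/
inductive Conflict : List Bool → List (Option Bool) → ℕ → ℕ → Prop
  | carry (P b Q : List Bool) (y : Option Bool) (ρ : List (Option Bool))
      (hP : ∀ x ∈ P, x = true) (hy : y ≠ carryDigit b.head?) :
      Conflict (P ++ b) (Q.map some ++ y :: ρ) P.length Q.length
  | overflow (P Q : List Bool) (y : Option Bool) (ρ : List (Option Bool))
      (hP : ∀ x ∈ P, x = true) (hy : y ≠ none) :
      Conflict P (Q.map some ++ some false :: y :: ρ) P.length Q.length
  | copy (P b Q : List Bool) (y : Option Bool) (ρ : List (Option Bool))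
      (hP : false ∈ P) (hy : y ≠ b.head?) :
      Conflict (P ++ b) (Q.map some ++ y :: ρ) P.length Q.length

theorem Conflict.length_le {b : List Bool} {ρ : List (Option Bool)} {p q : ℕ}
    (h : Conflict b ρ p q) : p ≤ b.length := by
  cases h <;> simp

theorem Conflict.exists_append {b : List Bool} {ρ : List (Option Bool)} {p q : ℕ}
    (h : Conflict b ρ p q) : ∃ (Q : List Bool) (ρ' : _), ρ = Q.map some ++ ρ' ∧ Q.length = q := by
  cases h <;> exact ⟨_, _, rfl, rfl⟩

theorem drop_prefix_of_append_prefix {T : Type u} {a b c d : List T} (hl : a.length = c.length)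
    (h : a ++ b <+: c ++ d) : b <+: d := by
  have := h.drop a.length
  rwa [List.drop_left, hl, List.drop_left] at this

/-- If `p = q`, dropping that many letters from `ρ` and from the true continuation exposes the same
position in both, where (for `overflow`, one letter later) the constructor asserts a mismatch. -/
theorem Conflict.ne {b : List Bool} {ρ : List (Option Bool)} {p q j n : ℕ} (h : Conflict b ρ p q)
    (hρ : ρ <+: (inc b).map some ++ counterStream j n) : p ≠ q := by
  cases h with
  | carry P b Q y ρ hP hy =>
    intro hl
    rw [inc_append_of_forall hP, List.map_append, List.append_assoc] at hρ
    have h := drop_prefix_of_append_prefix (by simp [hl]) hρ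
    rcases b with _ | ⟨_ | _, b⟩ <;>
      simp only [inc, List.map_cons, List.cons_append, List.cons_prefix_cons] at h <;>
      exact hy h.1
  | overflow P Q y ρ hP hy =>
    intro hl
    have hi := inc_append_of_forall hP []
    rw [List.append_nil, inc] at hi
    rw [hi, List.map_append, List.append_assoc] at hρ
    have h := drop_prefix_of_append_prefix (by simp [hl]) hρ
    simp only [List.map_cons, List.map_nil, List.cons_append, List.cons_prefix_cons] at h
    exact hy (exists_counterStream_of_cons_prefix h.2).1
  | copy P b Q y ρ hP hy =>
    intro hl
    obtain ⟨P', hP', hi⟩ := inc_append_of_mem hP b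
    rw [hi, List.map_append, List.append_assoc] at hρ
    have h := drop_prefix_of_append_prefix (by simp [hl, hP']) hρ
    cases b with
    | nil => exact hy (exists_counterStream_of_cons_prefix h).1
    | cons x b =>
      simp only [List.map_cons, List.cons_append, List.cons_prefix_cons] at h
      exact hy h.1

/-- The comparison once the carry has stopped and digits are merely copied. A block that breaks off
at the end of `ρ` is not an error. -/
theorem exists_ne_head_or_prefix (b : List Bool) (ρ : List (Option Bool)) :
    (∃ (P b' Q : List Bool) (y : Option Bool) (ρ' : List (Option Bool)), b = P ++ b' ∧
      ρ = Q.map some ++ y :: ρ' ∧ Q.length = P.length ∧ y ≠ b'.head?) ∨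
      ρ <+: b.map some ∨ b.map some ++ [none] <+: ρ := by
  induction b generalizing ρ with
  | nil =>
    rcases ρ with _ | ⟨_ | y, ρ⟩
    · simp
    · exact Or.inr (Or.inr (by simp))
    · exact Or.inl ⟨[], [], [], some y, ρ, rfl, rfl, rfl, by simp⟩
  | cons x b ih =>
    cases ρ with
    | nil => exact Or.inr (Or.inl List.nil_prefix)
    | cons y ρ =>
      by_cases hy : y = some x
      · subst hy
        rcases ih ρ with ⟨P, b', Q, y, ρ', rfl, rfl, hl, hy⟩ | h | h
        · exact Or.inl ⟨x :: P, b', x :: Q, y, ρ', rfl, rfl, by simp [hl], hy⟩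
        · exact Or.inr (Or.inl (by simpa using h))
        · exact Or.inr (Or.inr (by simpa using h))
      · exact Or.inl ⟨[], x :: b, [], y, ρ, rfl, rfl, rfl, by simpa using hy⟩

theorem Conflict.cons_true {b : List Bool} {ρ : List (Option Bool)} {p q : ℕ}
    (h : Conflict b ρ p q) : Conflict (true :: b) (some false :: ρ) (p + 1) (q + 1) := by
  cases h with
  | carry P b Q y ρ hP hy =>
    exact Conflict.carry (true :: P) b (false :: Q) y ρ (List.forall_mem_cons.2 ⟨rfl, hP⟩) hy
  | overflow P Q y ρ hP hy =>
    exact Conflict.overflow (true :: b) (false :: Q) y ρ (List.forall_mem_cons.2 ⟨rfl, hP⟩) hy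
  | copy P b Q y ρ hP hy =>
    exact Conflict.copy (true :: P) b (false :: Q) y ρ (List.mem_cons_of_mem _ hP) hy

/-- The comparison follows the recursion of `inc`: a leading `true` passes the carry on, the first
`false` ends it and leaves a copying problem. -/
theorem exists_conflict_or_prefix (b : List Bool) (ρ : List (Option Bool)) :
    (∃ p, Conflict b ρ p p) ∨ ρ <+: (inc b).map some ∨ (inc b).map some ++ [none] <+: ρ := by
  induction b generalizing ρ with
  | nil =>
    rcases ρ with _ | ⟨y, ρ⟩
    · exact Or.inr (Or.inl List.nil_prefix)
    · by_cases hy : y = some false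
      · subst hy
        rcases ρ with _ | ⟨_ | y, ρ⟩
        · exact Or.inr (Or.inl (by simp [inc]))
        · exact Or.inr (Or.inr (by simp [inc]))
        · exact Or.inl ⟨0, Conflict.overflow [] [] (some y) ρ (by simp) (by simp)⟩
      · exact Or.inl ⟨0, Conflict.carry [] [] [] y ρ (by simp) hy⟩
  | cons x b ih =>
    rcases ρ with _ | ⟨y, ρ⟩
    · exact Or.inr (Or.inl List.nil_prefix)
    · by_cases hy : y = some !x
      · subst hy
        cases x
        · rcases exists_ne_head_or_prefix b ρ with ⟨P, b', Q, y, ρ', rfl, rfl, hl, hy⟩ | h | h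
          · refine Or.inl ⟨P.length + 1, ?_⟩
            have := Conflict.copy (false :: P) b' (true :: Q) y ρ' List.mem_cons_self hy
            rwa [List.length_cons, List.length_cons, hl] at this
          · exact Or.inr (Or.inl (by simpa [inc] using h))
          · exact Or.inr (Or.inr (by simpa [inc] using h))
        · rcases ih ρ with ⟨p, h⟩ | h | h
          · exact Or.inl ⟨p + 1, h.cons_true⟩
          · exact Or.inr (Or.inl (by simpa [inc] using h))
          · exact Or.inr (Or.inr (by simpa [inc] using h))
      · exact Or.inl ⟨0, Conflict.carry [] (x :: b) [] y ρ (by simp) hy⟩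

/-- Two consecutive blocks of `s` witness that `s` is not a sequence of counters if `p = q`. -/
def SuccDispute (s : List (Option Bool)) (p q : ℕ) : Prop :=
  ∃ (α : List (Option Bool)) (b : List Bool) (ρ : List (Option Bool)),
    s = α ++ none :: (b.map some ++ none :: ρ) ∧ Conflict b ρ p q

/-- The last two blocks of `s` and `s'` witness that `s ≠ s'` if `p = q`. -/
inductive TailDispute : List (Option Bool) → List (Option Bool) → ℕ → ℕ → Prop
  | block (α α' : List (Option Bool)) (P b t P' b' t' : List Bool) (h : b.head? ≠ b'.head?) :
      TailDispute (α ++ none :: ((P ++ b).map some ++ none :: t.map some))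
        (α' ++ none :: ((P' ++ b').map some ++ none :: t'.map some)) P.length P'.length
  | rest (α α' : List (Option Bool)) (P b P' b' : List Bool) (h : b.head? ≠ b'.head?) :
      TailDispute (α ++ none :: (P ++ b).map some)
        (α' ++ none :: (P' ++ b').map some) P.length P'.length

/-- The ways of disputing that `s` and `s'` are the same sequence of counters. -/
def Dispute (s s' : List (Option Bool)) (p q : ℕ) : Prop :=
  SuccDispute s p q ∨ SuccDispute s' p q ∨ TailDispute s s' p q

/-- A word splits in only one way at its last separator. -/
theorem append_none_cons_inj {α α' : List (Option Bool)} {t t' : List Bool}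
    (h : α ++ none :: t.map some = α' ++ none :: t'.map some) : α = α' ∧ t = t' := by
  have key : ∀ {β : List (Option Bool)} {u v : List Bool}, β ≠ [] →
      none :: u.map some ≠ β ++ none :: v.map some := by
    rintro (_ | ⟨x, β⟩) u v hβ h
    · exact hβ rfl
    · have h' : none ∈ u.map some := by
        rw [(List.cons.inj h).2]
        simp
      simp at h'
  rcases List.append_eq_append_iff.1 h with ⟨β, rfl, h'⟩ | ⟨β, rfl, h'⟩
  · by_cases hβ : β = []
    · subst hβ
      simpa [(Option.some_injective Bool).list_map.eq_iff] using h'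
    · exact absurd h' (key hβ)
  · by_cases hβ : β = []
    · subst hβ
      simpa [(Option.some_injective Bool).list_map.eq_iff, eq_comm] using h'
    · exact absurd h' (key hβ)

theorem TailDispute.ne {s s' : List (Option Bool)} {p q : ℕ} (h : TailDispute s s' p q)
    (hs : s = s') : p ≠ q := by
  have key : ∀ {P b P' b' : List Bool}, P ++ b = P' ++ b' → b.head? ≠ b'.head? →
      P.length ≠ P'.length := fun h hb hl => hb (by rw [(List.append_inj h hl).2])
  cases h with
  | block α α' P b t P' b' t' hb =>
    have h1 : ∀ {α : List (Option Bool)} {c t : List Bool}, α ++ none :: (c.map some ++ none ::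
      t.map some) = (α ++ none :: c.map some) ++ none :: t.map some := by simp
    rw [h1, h1] at hs
    exact key (append_none_cons_inj (append_none_cons_inj hs).1).2 hb
  | rest α α' P b P' b' hb => exact key (append_none_cons_inj hs).2 hb

theorem length_of_prefix_counter {c : List Bool} {α β : List (Option Bool)}
    (h : c <+: counter (α.count none)) {P : List Bool} (hP : P <+: c) :
    2 ^ P.length ≤ (α ++ none :: β).length := by
  refine two_pow_le_of_length_le (hP.trans h).length_le ?_
  have := α.count_le_length (a := none)
  simp only [List.length_append, List.length_cons]
  omega

theorem TailDispute.two_pow_le {s s' : List (Option Bool)} {p q : ℕ} (h : TailDispute s s' p q)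
    (hs : IsCount s) (hs' : IsCount s') : 2 ^ p ≤ s.length ∧ 2 ^ q ≤ s'.length := by
  cases h with
  | block α α' P b t P' b' t' hb =>
    exact ⟨length_of_prefix_counter hs.block (List.prefix_append _ _),
      length_of_prefix_counter hs'.block (List.prefix_append _ _)⟩
  | rest α α' P b P' b' hb =>
    exact ⟨length_of_prefix_counter (IsCount.block (β := []) (by simpa using hs))
        (List.prefix_append _ _),
      length_of_prefix_counter (IsCount.block (β := []) (by simpa using hs'))
        (List.prefix_append _ _)⟩

theorem SuccDispute.of_isCount {s : List (Option Bool)} (hs : IsCount s) {p q : ℕ}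
    (h : SuccDispute s p q) : p ≠ q ∧ 2 ^ p ≤ s.length ∧ 2 ^ q ≤ s.length := by
  obtain ⟨α, b, ρ, rfl, h⟩ := h
  obtain ⟨n, hn⟩ := hs.next_block
  refine ⟨h.ne hn, ?_, ?_⟩
  · have := length_of_prefix_counter (β := b.map some ++ none :: ρ) hs.block
      (List.take_prefix p b)
    rwa [List.length_take_of_le h.length_le] at this
  -- The second factor opens the block after `b`, so its bound is that of the next counter.
  · obtain ⟨Q, ρ', rfl, rfl⟩ := h.exists_append
    have hs' : IsCount ((α ++ none :: b.map some) ++ none :: (Q.map some ++ ρ')) := by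
      simpa using hs
    have := length_of_prefix_counter (β := Q.map some ++ ρ') hs'.block List.prefix_rfl
    simpa using this

/-- Why honest labels on equal factors are safe. Both lengths need a bound, since a false objection
may involve two different ones. -/
theorem Dispute.of_isCount {s : List (Option Bool)} (hs : IsCount s) {p q : ℕ}
    (h : Dispute s s p q) : p ≠ q ∧ 2 ^ p ≤ s.length ∧ 2 ^ q ≤ s.length := by
  rcases h with h | h | h
  · exact h.of_isCount hs
  · exact h.of_isCount hs
  · exact ⟨h.ne rfl, h.two_pow_le hs hs⟩

/-! ### Existence of a justified dispute. -/

theorem exists_common_prefix {T : Type u} {a b : List T} (h : a ≠ b) :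
    ∃ P a' b', a = P ++ a' ∧ b = P ++ b' ∧ a'.head? ≠ b'.head? := by
  induction a generalizing b with
  | nil =>
    cases b with
    | nil => exact absurd rfl h
    | cons y b => exact ⟨[], [], y :: b, rfl, rfl, by simp⟩
  | cons x a ih =>
    cases b with
    | nil => exact ⟨[], x :: a, [], rfl, rfl, by simp⟩
    | cons y b =>
      by_cases hxy : x = y
      · subst hxy
        obtain ⟨P, a', b', rfl, rfl, h'⟩ := ih (fun hab => h (by rw [hab]))
        exact ⟨x :: P, a', b', rfl, rfl, h'⟩
      · exact ⟨[], x :: a, y :: b, rfl, rfl, by simpa using hxy⟩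

/-- The blocks are checked from the left, `counterStream 0 (j + 1)` being the part already verified.
The first error comes after correct counters only, so the block at fault is logarithmically short
however wild the later labels are. -/
theorem exists_succDispute_or_eq (j : ℕ) (ρ : List (Option Bool)) :
    (∃ p, 2 ^ p ≤ (counterStream 0 (j + 1) ++ none :: ρ).length ∧
      SuccDispute (counterStream 0 (j + 1) ++ none :: ρ) p p) ∨
    ∃ k t, counterStream 0 (j + 1) ++ none :: ρ = counterStream 0 (k + 1) ++ none :: t.map some ∧
      t <+: counter (k + 1) := by
  induction hn : ρ.length using Nat.strong_induction_on generalizing j ρ with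
  | _ n ih =>
    subst hn
    rcases exists_conflict_or_prefix (counter j) ρ with ⟨p, h⟩ | h | ⟨ρ, rfl⟩
    · refine Or.inl ⟨p, two_pow_le_of_length_le h.length_le ?_,
        counterStream 0 j, counter j, ρ, ?_, h⟩
      · have := le_length_counterStream 0 (j + 1)
        simp only [List.length_append]
        omega
      · simp [counterStream_succ 0 j]
    · obtain ⟨t, ht, rfl⟩ := List.prefix_map_iff.1 h
      exact Or.inr ⟨j, t, rfl, ht⟩
    · have h := ih ρ.length (by simp; omega) (j + 1) ρ rfl
      rw [counterStream_succ 0 (j + 1), Nat.zero_add] at h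
      simpa [counter] using h

/-- If neither word has an internal error, both are initial segments of one stream. As their lengths
differ, so do their penultimate blocks or, when these agree, their last ones; the common prefix
before the first difference supplies two factors of equal length. Hence a bound against either word
is enough. -/
theorem exists_dispute {s s' : List (Option Bool)} (hs : ∃ t, s = none :: none :: t)
    (hs' : ∃ t, s' = none :: none :: t) (hl : s.length ≠ s'.length) :
    ∃ p, (2 ^ p ≤ s.length ∨ 2 ^ p ≤ s'.length) ∧ Dispute s s' p p := by
  obtain ⟨t, rfl⟩ := hs
  obtain ⟨t', rfl⟩ := hs'
  rcases exists_succDispute_or_eq 0 t with ⟨p, hp, h⟩ | ⟨k, c, h1, h2⟩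
  · exact ⟨p, Or.inl hp, Or.inl h⟩
  rcases exists_succDispute_or_eq 0 t' with ⟨p, hp, h⟩ | ⟨k', c', h1', h2'⟩
  · exact ⟨p, Or.inr hp, Or.inr (Or.inl h)⟩
  -- The first separator with the empty counter 0 is a complete block; the second one opens the next
  -- block.
  have h0 : ∀ u, none :: none :: u = counterStream 0 (0 + 1) ++ none :: u := fun _ => rfl
  rw [h0 t, h1, h0 t', h1'] at hl ⊢
  by_cases hk : k = k'
  · subst hk
    have hc : c ≠ c' := fun h => hl (by rw [h])
    obtain ⟨P, b, b', rfl, rfl, hb⟩ := exists_common_prefix hc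
    refine ⟨P.length, Or.inl ?_, Or.inr (Or.inr (TailDispute.rest _ _ P b P b' hb))⟩
    refine two_pow_le_of_length_le ((List.prefix_append P b).trans h2).length_le ?_
    have := le_length_counterStream 0 (k + 1)
    simp only [List.length_append, List.length_cons]
    omega
  · obtain ⟨P, b, b', hP, hP', hb⟩ := exists_common_prefix (counter_injective.ne hk)
    refine ⟨P.length, Or.inl ?_, Or.inr (Or.inr ?_)⟩
    · refine two_pow_le_of_length_le (n := k) (by simp [hP]) ?_
      have := le_length_counterStream 0 (k + 1)
      simp only [List.length_append, List.length_cons]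
      omega
    · have := TailDispute.block (counterStream 0 k) (counterStream 0 k') P b c P b' c' hb
      rw [← hP, ← hP'] at this
      simpa [counterStream_succ] using this

/-! ### Patterns -/

/-- A set of factorizations of words into five factors. -/
structure Pattern (T : Type u) where
  A : Language T
  P : Language T
  B : Language T
  Q : Language T
  C : Language T

namespace Pattern

variable {T : Type u}

/-- The five factors of the pattern are regular. -/
structure IsRegular (π : Pattern T) : Prop where
  A : π.A.IsRegular
  P : π.P.IsRegular
  B : π.B.IsRegular
  Q : π.Q.IsRegular
  C : π.C.IsRegular

/-- `A`, `P`, `B`, `Q`, `C` is a factorization of `r` of the form `π`. -/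
structure Splits (π : Pattern T) (r A P B Q C : List T) : Prop where
  memA : A ∈ π.A
  memP : P ∈ π.P
  memB : B ∈ π.B
  memQ : Q ∈ π.Q
  memC : C ∈ π.C
  eq : r = A ++ (P ++ (B ++ (Q ++ C)))

end Pattern

/-- Some factorization of `r` whose form is in `S` has second and fourth factors of lengths `p` and
`q`. -/
def Occurs {T : Type u} (S : Set (Pattern T)) (r : List T) (p q : ℕ) : Prop :=
  ∃ π ∈ S, ∃ A P B Q C, π.Splits r A P B Q C ∧ P.length = p ∧ Q.length = q

/-! ### The register alphabet and the moves -/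

/-- The letters in the register: those of the input, a blank, two kinds of labels, and the letters
of a register with which a player resigns, and of a register with which a player has won. -/
inductive Reg (α : Type u) where
  | input (a : PadSym α)
  | blank
  | seg (i : Bool) (l : Option Bool)
  | resign
  | dead

namespace Reg

variable {α : Type u}

instance [Finite α] : Finite (PadSym α) :=
  Finite.of_surjective (fun x : α ⊕ Bool => match x with
    | .inl a => PadSym.letter a
    | .inr true => PadSym.hash
    | .inr false => PadSym.dollar) (by
      rintro (a | _ | _)
      · exact ⟨.inl a, rfl⟩
      · exact ⟨.inr true, rfl⟩
      · exact ⟨.inr false, rfl⟩)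

instance [Finite α] : Finite (Reg α) :=
  Finite.of_surjective (fun x : PadSym α ⊕ (Bool × Option Bool) ⊕ Option Bool => match x with
    | .inl a => input a
    | .inr (.inl x) => seg x.1 x.2
    | .inr (.inr none) => blank
    | .inr (.inr (some true)) => resign
    | .inr (.inr (some false)) => dead) (by
      rintro (a | _ | ⟨i, l⟩ | _ | _)
      · exact ⟨.inl a, rfl⟩
      · exact ⟨.inr (.inr none), rfl⟩
      · exact ⟨.inr (.inl (i, l)), rfl⟩
      · exact ⟨.inr (.inr (some true)), rfl⟩
      · exact ⟨.inr (.inr (some false)), rfl⟩)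

/-- The letter is neither `resign` nor `dead`. -/
def Live (a : Reg α) : Prop := a ≠ resign ∧ a ≠ dead

/-- The register in which two segments carry the labels `s` and `s'`. -/
def frame (a : ℕ) (s : List (Option Bool)) (b : ℕ) (s' : List (Option Bool)) (c : ℕ) :
    List (Reg α) :=
  List.replicate a blank ++ (s.map (seg false) ++ (List.replicate b blank ++
    (s'.map (seg true) ++ List.replicate c blank)))

/-- A player disputes the opponent's claim by two factors of equal length at most `1`. -/
def shortMove (π : Pattern (Reg α)) (k : ℕ) : Set (List (Reg α) × List (Reg α)) :=
  {p | (∃ A P B Q C : List (Reg α), π.Splits p.1 A P B Q C ∧ P.length = k ∧ Q.length = k) ∧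
    p.2 = List.replicate p.1.length dead}

/-- A player disputes the opponent's claim by two longer factors, and labels them. -/
def longMove (π : Pattern (Reg α)) : Set (List (Reg α) × List (Reg α)) :=
  {p | ∃ A P B Q C, π.Splits p.1 A P B Q C ∧ ∃ s s', (∃ t, s = none :: none :: t) ∧
    (∃ t, s' = none :: none :: t) ∧ s.length = P.length ∧ s'.length = Q.length ∧
    p.2 = frame A.length s B.length s' C.length}

/-- A player resigns. -/
def resignMove (α : Type u) : Set (List (Reg α) × List (Reg α)) :=
  relBox (oneL Live * allL fun _ => True) (allL (· = resign))

/-- A player accepts the resignation of the opponent. -/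
def acceptMove (α : Type u) : Set (List (Reg α) × List (Reg α)) :=
  relBox (oneL (· = resign) * allL fun _ => True) (allL (· = dead))

/-- The instructions for disputes of the forms in `S`. -/
def disputeMoves (S : Set (Pattern (Reg α))) : Set (Set (List (Reg α) × List (Reg α))) :=
  longMove '' S ∪ ((shortMove · 0) '' S ∪ (shortMove · 1) '' S)

theorem finite_disputeMoves {S : Set (Pattern (Reg α))} (h : S.Finite) :
    (disputeMoves S).Finite :=
  (h.image _).union ((h.image _).union (h.image _))

/-! ### Regularity of the moves. -/

theorem isSyncRegular_shortMove {π : Pattern (Reg α)} (hπ : π.IsRegular) (k : ℕ) :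
    IsSyncRegular (shortMove π k) := by
  convert IsSyncRegular.box (hπ.A.mul ((hπ.P.inf (isRegular_lenL k)).mul
    (hπ.B.mul ((hπ.Q.inf (isRegular_lenL k)).mul hπ.C)))) (isRegular_allL (· = dead)) using 1
  ext ⟨r, x⟩
  constructor
  · rintro ⟨⟨A, P, B, Q, C, ⟨hA, hP, hB, hQ, hC, rfl⟩, hPk, hQk⟩, hx⟩
    dsimp only at hx
    subst hx
    refine ⟨append_mem_mul hA (append_mem_mul ⟨hP, mem_lenL.2 hPk⟩ (append_mem_mul hB
      (append_mem_mul ⟨hQ, mem_lenL.2 hQk⟩ hC))), ?_, by simp⟩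
    exact fun a ha => List.eq_of_mem_replicate ha
  · rintro ⟨⟨A, hA, _, ⟨P, ⟨hP, hPk⟩, _, ⟨B, hB, _, ⟨Q, ⟨hQ, hQk⟩, C, hC, rfl⟩, rfl⟩, rfl⟩, h⟩,
      hx, hl⟩
    exact ⟨⟨A, P, B, Q, C, ⟨hA, hP, hB, hQ, hC, h.symm⟩, mem_lenL.1 hPk, mem_lenL.1 hQk⟩,
      List.eq_replicate_iff.2 ⟨hl.symm, hx⟩⟩

/-- The words of labels of kind `i` that start with two separators. -/
def startL (α : Type u) (i : Bool) : Language (Reg α) :=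
  oneL (· = seg i none) * (oneL (· = seg i none) * allL fun a => ∃ l, a = seg i l)

theorem mem_allL_seg {i : Bool} {w : List (Reg α)} :
    w ∈ allL (fun a : Reg α => ∃ l, a = seg i l) ↔
      ∃ s : List (Option Bool), w = s.map (seg i) := by
  rw [mem_allL]
  constructor
  · intro h
    induction w with
    | nil => exact ⟨[], rfl⟩
    | cons a w ih =>
      rw [List.forall_mem_cons] at h
      obtain ⟨⟨l, rfl⟩, h⟩ := h
      obtain ⟨s, rfl⟩ := ih h
      exact ⟨l :: s, rfl⟩
  · rintro ⟨s, rfl⟩ a ha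
    obtain ⟨l, -, rfl⟩ := List.mem_map.1 ha
    exact ⟨l, rfl⟩

theorem mem_startL {i : Bool} {w : List (Reg α)} :
    w ∈ startL α i ↔ ∃ s : List (Option Bool), (∃ t, s = none :: none :: t) ∧ w = s.map (seg i) := by
  constructor
  · rintro ⟨_, ⟨_, rfl, rfl⟩, _, ⟨_, ⟨_, rfl, rfl⟩, t, ht, rfl⟩, rfl⟩
    obtain ⟨s, rfl⟩ := mem_allL_seg.1 ht
    exact ⟨none :: none :: s, ⟨s, rfl⟩, rfl⟩
  · rintro ⟨_, ⟨t, rfl⟩, rfl⟩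
    exact append_mem_mul (a := [seg i none]) ⟨_, rfl, rfl⟩ (append_mem_mul (a := [seg i none])
      ⟨_, rfl, rfl⟩ (mem_allL_seg.2 ⟨t, rfl⟩))

theorem isRegular_startL (i : Bool) : (startL α i).IsRegular :=
  (isRegular_oneL _).mul ((isRegular_oneL _).mul (isRegular_allL _))

/-- The five factors are overwritten independently, each by a word of its own length, so the move is
a product of boxes. No regular condition ties the two label words together; exposing their flaws is
left to the opponent. -/
theorem isSyncRegular_longMove {π : Pattern (Reg α)} (hπ : π.IsRegular) :
    IsSyncRegular (longMove π) := by
  have hN := isRegular_allL (T := Reg α) (· = blank)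
  convert (IsSyncRegular.box hπ.A hN).mul ((IsSyncRegular.box hπ.P (isRegular_startL false)).mul
    ((IsSyncRegular.box hπ.B hN).mul ((IsSyncRegular.box hπ.Q (isRegular_startL true)).mul
      (IsSyncRegular.box hπ.C hN)))) using 1
  have hb : ∀ n, List.replicate n (blank : Reg α) ∈ allL (· = (blank : Reg α)) :=
    fun n a ha => List.eq_of_mem_replicate ha
  ext ⟨r, x⟩
  constructor
  · rintro ⟨A, P, B, Q, C, ⟨hA, hP, hB, hQ, hC, rfl⟩, s, s', hs, hs', hl, hl', rfl⟩
    exact ⟨(_, _), ⟨hA, hb _, by simp⟩, (_, _), ⟨(_, _), ⟨hP, mem_startL.2 ⟨s, hs, rfl⟩,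
      by simp [hl]⟩, (_, _), ⟨(_, _), ⟨hB, hb _, by simp⟩, (_, _), ⟨(_, _), ⟨hQ,
      mem_startL.2 ⟨s', hs', rfl⟩, by simp [hl']⟩, (_, _), ⟨hC, hb _, by simp⟩, rfl⟩, rfl⟩, rfl⟩,
      rfl⟩
  · rintro ⟨⟨A, A'⟩, ⟨hA, hA', hAl⟩, _, ⟨⟨P, P'⟩, ⟨hP, hP', hPl⟩, _, ⟨⟨B, B'⟩, ⟨hB, hB', hBl⟩, _,
      ⟨⟨Q, Q'⟩, ⟨hQ, hQ', hQl⟩, ⟨C, C'⟩, ⟨hC, hC', hCl⟩, rfl⟩, rfl⟩, rfl⟩, h⟩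
    obtain ⟨rfl, rfl⟩ := Prod.ext_iff.1 h
    obtain ⟨s, hs, rfl⟩ := mem_startL.1 hP'
    obtain ⟨s', hs', rfl⟩ := mem_startL.1 hQ'
    have hA'' := List.eq_replicate_iff.2 ⟨hAl.symm, hA'⟩
    have hB'' := List.eq_replicate_iff.2 ⟨hBl.symm, hB'⟩
    have hC'' := List.eq_replicate_iff.2 ⟨hCl.symm, hC'⟩
    dsimp only at hA'' hB'' hC'' hPl hQl
    rw [List.length_map] at hPl hQl
    refine ⟨A, P, B, Q, C, ⟨hA, hP, hB, hQ, hC, rfl⟩, s, s', hs, hs', hPl.symm, hQl.symm, ?_⟩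
    dsimp only
    rw [hA'', hB'', hC'']
    simp [frame]

theorem isSyncRegular_of_mem_disputeMoves {S : Set (Pattern (Reg α))}
    (hS : ∀ π ∈ S, π.IsRegular) {J : Set (List (Reg α) × List (Reg α))}
    (hJ : J ∈ disputeMoves S) : IsSyncRegular J := by
  rcases hJ with ⟨π, hπ, rfl⟩ | ⟨π, hπ, rfl⟩ | ⟨π, hπ, rfl⟩
  · exact isSyncRegular_longMove (hS π hπ)
  · exact isSyncRegular_shortMove (hS π hπ) 0
  · exact isSyncRegular_shortMove (hS π hπ) 1

theorem isSyncRegular_resignMove : IsSyncRegular (resignMove α) :=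
  IsSyncRegular.box ((isRegular_oneL _).mul (isRegular_allL _)) (isRegular_allL _)

theorem isSyncRegular_acceptMove : IsSyncRegular (acceptMove α) :=
  IsSyncRegular.box ((isRegular_oneL _).mul (isRegular_allL _)) (isRegular_allL _)

theorem mem_resignMove {r x : List (Reg α)} :
    (r, x) ∈ resignMove α ↔ (∃ a t, r = a :: t ∧ a.Live) ∧ x = List.replicate r.length resign := by
  constructor
  · rintro ⟨⟨_, ⟨a, ha, rfl⟩, t, -, rfl⟩, hx, hl⟩
    exact ⟨⟨a, t, rfl, ha⟩, List.eq_replicate_iff.2 ⟨hl.symm, hx⟩⟩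
  · rintro ⟨⟨a, t, rfl, ha⟩, rfl⟩
    exact ⟨append_mem_mul (a := [a]) ⟨a, ha, rfl⟩ (b := t) fun _ _ => trivial,
      fun a ha => List.eq_of_mem_replicate ha, by simp⟩

theorem mem_acceptMove {r x : List (Reg α)} :
    (r, x) ∈ acceptMove α ↔ (∃ t, r = resign :: t) ∧ x = List.replicate r.length dead := by
  constructor
  · rintro ⟨⟨_, ⟨_, rfl, rfl⟩, t, -, rfl⟩, hx, hl⟩
    exact ⟨⟨t, rfl⟩, List.eq_replicate_iff.2 ⟨hl.symm, hx⟩⟩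
  · rintro ⟨⟨t, rfl⟩, rfl⟩
    exact ⟨append_mem_mul (a := [resign]) ⟨_, rfl, rfl⟩ (b := t) fun _ _ => trivial,
      fun a ha => List.eq_of_mem_replicate ha, by simp⟩

/-- The possible results of a dispute. -/
theorem of_mem_disputeMoves {S : Set (Pattern (Reg α))} {J : Set (List (Reg α) × List (Reg α))}
    (hJ : J ∈ disputeMoves S) {r x : List (Reg α)} (hx : (r, x) ∈ J) :
    (∃ p, Occurs S r p p) ∧ x = List.replicate r.length dead ∨
    ∃ a s b s' c, Occurs S r s.length s'.length ∧ (∃ t, s = none :: none :: t) ∧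
      (∃ t, s' = none :: none :: t) ∧ x = frame a s b s' c := by
  rcases hJ with ⟨π, hπ, rfl⟩ | ⟨π, hπ, rfl⟩ | ⟨π, hπ, rfl⟩
  · obtain ⟨A, P, B, Q, C, h, s, s', hs, hs', hl, hl', rfl⟩ := hx
    exact Or.inr ⟨_, s, _, s', _, ⟨π, hπ, A, P, B, Q, C, h, hl.symm, hl'.symm⟩, hs, hs', rfl⟩
  · obtain ⟨⟨A, P, B, Q, C, h, hl⟩, hx⟩ := hx
    exact Or.inl ⟨⟨0, π, hπ, A, P, B, Q, C, h, hl⟩, hx⟩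
  · obtain ⟨⟨A, P, B, Q, C, h, hl⟩, hx⟩ := hx
    exact Or.inl ⟨⟨1, π, hπ, A, P, B, Q, C, h, hl⟩, hx⟩

/-- A justified dispute can be raised with honest labels. -/
theorem exists_mem_disputeMoves {S : Set (Pattern (Reg α))} {r : List (Reg α)} {p : ℕ}
    (h : Occurs S r p p) : ∃ J ∈ disputeMoves S, (r, List.replicate r.length dead) ∈ J ∨
      ∃ a s b c, IsCount s ∧ s.length = p ∧ 2 ≤ p ∧ (r, frame a s b s c) ∈ J := by
  obtain ⟨π, hπ, A, P, B, Q, C, h, hP, hQ⟩ := h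
  -- Lengths 0 and 1 leave no room for the two initial separators; there a finite automaton checks
  -- equality and the game ends at once.
  rcases p with _ | _ | p
  · exact ⟨_, Or.inr (Or.inl ⟨π, hπ, rfl⟩), Or.inl ⟨⟨A, P, B, Q, C, h, hP, hQ⟩, rfl⟩⟩
  · exact ⟨_, Or.inr (Or.inr ⟨π, hπ, rfl⟩), Or.inl ⟨⟨A, P, B, Q, C, h, hP, hQ⟩, rfl⟩⟩
  · obtain ⟨s, hs, hl, ht⟩ := IsCount.exists_of_length (m := p + 2) (by omega)
    exact ⟨_, Or.inl ⟨π, hπ, rfl⟩, Or.inr ⟨_, s, _, _, hs, hl, by omega, A, P, B, Q, C, h, s, s,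
      ht, ht, hl.trans hP.symm, hl.trans hQ.symm, rfl⟩⟩

end Reg

/-! ### Disputes about labels -/

namespace Reg

variable {α : Type u}

/-- The words that consist of the letter `seg i l`. -/
def litL (i : Bool) (l : Option Bool) : Language (Reg α) := oneL (· = seg i l)

/-- The words that consist of digits of kind `i`. -/
def digitsL (i : Bool) : Language (Reg α) := allL fun a => ∃ b, a = seg i (some b)

/-- The words that consist of digits of kind `i` and start with `z`; the empty word if `z` is
`none`. -/
def restL (i : Bool) : Option Bool → Language (Reg α)
  | none => 1
  | some b => litL i (some b) * digitsL i

/-- The words without labels of kind `i`. -/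
def notSegL (i : Bool) : Language (Reg α) := allL fun a => ∀ l, a ≠ seg i l

/-- The words that consist of the digit `true` of kind `i`. -/
def onesL (i : Bool) : Language (Reg α) := allL (· = seg i (some true))

/-- The words that consist of blanks. -/
def blankL (α : Type u) : Language (Reg α) := allL (· = blank)

/-- All words. -/
def anyL (α : Type u) : Language (Reg α) := allL fun _ => True

theorem isRegular_litL (i : Bool) (l : Option Bool) : (litL i l : Language (Reg α)).IsRegular :=
  isRegular_oneL _

theorem isRegular_digitsL (i : Bool) : (digitsL i : Language (Reg α)).IsRegular :=
  isRegular_allL _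

theorem isRegular_restL (i : Bool) (z : Option Bool) :
    (restL i z : Language (Reg α)).IsRegular := by
  cases z with
  | none => exact isRegular_one
  | some b => exact (isRegular_litL _ _).mul (isRegular_digitsL _)

theorem isRegular_notSegL (i : Bool) : (notSegL i : Language (Reg α)).IsRegular :=
  isRegular_allL _

theorem isRegular_onesL (i : Bool) : (onesL i : Language (Reg α)).IsRegular :=
  isRegular_allL _

theorem isRegular_blankL : (blankL α).IsRegular := isRegular_allL _

theorem isRegular_anyL : (anyL α).IsRegular := isRegular_allL _

/-- The forms of disputes about a register with two labelled segments. -/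
inductive IsLabelPattern : Pattern (Reg α) → Prop
  | carry (i : Bool) (z y : Option Bool) (h : y ≠ carryDigit z) : IsLabelPattern
      ⟨anyL α * litL i none, onesL i, restL i z * litL i none, digitsL i, litL i y * anyL α⟩
  | overflow (i : Bool) (y : Option Bool) (h : y ≠ none) : IsLabelPattern
      ⟨anyL α * litL i none, onesL i, litL i none, digitsL i,
        litL i (some false) * (litL i y * anyL α)⟩
  | copy (i : Bool) (z y : Option Bool) (h : y ≠ z) : IsLabelPattern
      ⟨anyL α * litL i none, digitsL i * (litL i (some false) * digitsL i),
        restL i z * litL i none, digitsL i, litL i y * anyL α⟩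
  | block (z z' : Option Bool) (h : z ≠ z') : IsLabelPattern
      ⟨anyL α * litL false none, digitsL false,
        restL false z * (litL false none * (digitsL false * (notSegL false * litL true none))),
        digitsL true, restL true z' * (litL true none * (digitsL true * blankL α))⟩
  | rest (z z' : Option Bool) (h : z ≠ z') : IsLabelPattern
      ⟨anyL α * litL false none, digitsL false, restL false z * (notSegL false * litL true none),
        digitsL true, restL true z' * blankL α⟩

theorem IsLabelPattern.isRegular {π : Pattern (Reg α)} (h : IsLabelPattern π) : π.IsRegular := by
  have hany := isRegular_anyL (α := α)
  have hlit := isRegular_litL (α := α)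
  have hdig := isRegular_digitsL (α := α)
  have hrest := isRegular_restL (α := α)
  have hnot := isRegular_notSegL (α := α)
  have hone := isRegular_onesL (α := α)
  have hblank := isRegular_blankL (α := α)
  cases h with
  | carry i z y h =>
    exact ⟨hany.mul (hlit _ _), hone _, (hrest _ _).mul (hlit _ _), hdig _, (hlit _ _).mul hany⟩
  | overflow i y h =>
    exact ⟨hany.mul (hlit _ _), hone _, hlit _ _, hdig _, (hlit _ _).mul ((hlit _ _).mul hany)⟩
  | copy i z y h =>
    exact ⟨hany.mul (hlit _ _), (hdig _).mul ((hlit _ _).mul (hdig _)),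
      (hrest _ _).mul (hlit _ _), hdig _, (hlit _ _).mul hany⟩
  | block z z' h =>
    exact ⟨hany.mul (hlit _ _), hdig _,
      (hrest _ _).mul ((hlit _ _).mul ((hdig _).mul ((hnot _).mul (hlit _ _)))), hdig _,
      (hrest _ _).mul ((hlit _ _).mul ((hdig _).mul hblank))⟩
  | rest z z' h =>
    exact ⟨hany.mul (hlit _ _), hdig _, (hrest _ _).mul ((hnot _).mul (hlit _ _)), hdig _,
      (hrest _ _).mul hblank⟩

variable (α) in
theorem finite_setOf_isLabelPattern : {π : Pattern (Reg α) | IsLabelPattern π}.Finite := by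
  refine (((Set.finite_range fun x : Bool × Option Bool × Option Bool => (⟨anyL α * litL x.1 none,
    onesL x.1, restL x.1 x.2.1 * litL x.1 none, digitsL x.1, litL x.1 x.2.2 * anyL α⟩ :
    Pattern (Reg α))).union <| (Set.finite_range fun x : Bool × Option Bool =>
    (⟨anyL α * litL x.1 none, onesL x.1, litL x.1 none, digitsL x.1,
    litL x.1 (some false) * (litL x.1 x.2 * anyL α)⟩ : Pattern (Reg α))).union <|
    (Set.finite_range fun x : Bool × Option Bool × Option Bool => (⟨anyL α * litL x.1 none,
    digitsL x.1 * (litL x.1 (some false) * digitsL x.1), restL x.1 x.2.1 * litL x.1 none,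
    digitsL x.1, litL x.1 x.2.2 * anyL α⟩ : Pattern (Reg α))).union <|
    (Set.finite_range fun x : Option Bool × Option Bool => (⟨anyL α * litL false none,
    digitsL false, restL false x.1 * (litL false none * (digitsL false * (notSegL false *
    litL true none))), digitsL true, restL true x.2 * (litL true none * (digitsL true *
    blankL α))⟩ : Pattern (Reg α))).union
    (Set.finite_range fun x : Option Bool × Option Bool => (⟨anyL α * litL false none,
    digitsL false, restL false x.1 * (notSegL false * litL true none), digitsL true,
    restL true x.2 * blankL α⟩ : Pattern (Reg α))))).subset ?_
  intro π h
  cases h with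
  | carry i z y h => exact Or.inl ⟨(i, z, y), rfl⟩
  | overflow i y h => exact Or.inr (Or.inl ⟨(i, y), rfl⟩)
  | copy i z y h => exact Or.inr (Or.inr (Or.inl ⟨(i, z, y), rfl⟩))
  | block z z' h => exact Or.inr (Or.inr (Or.inr (Or.inl ⟨(z, z'), rfl⟩)))
  | rest z z' h => exact Or.inr (Or.inr (Or.inr (Or.inr ⟨(z, z'), rfl⟩)))

/-- Labels of kind `i` that are digits. -/
def digits (i : Bool) (b : List Bool) : List (Reg α) := (b.map some).map (seg i)

theorem length_digits (i : Bool) (b : List Bool) : (digits i b : List (Reg α)).length = b.length := by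
  simp [digits]

theorem mem_digitsL {i : Bool} {w : List (Reg α)} : w ∈ digitsL i ↔ ∃ b, w = digits i b := by
  constructor
  · intro h
    induction w with
    | nil => exact ⟨[], rfl⟩
    | cons a w ih =>
      obtain ⟨⟨b, rfl⟩, h'⟩ := List.forall_mem_cons.1 h
      obtain ⟨s, rfl⟩ := ih h'
      exact ⟨b :: s, rfl⟩
  · rintro ⟨s, rfl⟩ a ha
    obtain ⟨l, hl, rfl⟩ := List.mem_map.1 ha
    obtain ⟨b, -, rfl⟩ := List.mem_map.1 hl
    exact ⟨b, rfl⟩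

theorem mem_onesL {i : Bool} {w : List (Reg α)} :
    w ∈ onesL i ↔ ∃ b, (∀ x ∈ b, x = true) ∧ w = digits i b := by
  constructor
  · intro h
    obtain ⟨b, rfl⟩ := mem_digitsL.1 fun a ha => ⟨true, h a ha⟩
    refine ⟨b, fun x hx => ?_, rfl⟩
    have := h (seg i (some x)) (List.mem_map_of_mem (List.mem_map_of_mem hx))
    injection this with _ h
    exact Option.some_injective _ h
  · rintro ⟨b, hb, rfl⟩ a ha
    obtain ⟨l, hl, rfl⟩ := List.mem_map.1 ha
    obtain ⟨x, hx, rfl⟩ := List.mem_map.1 hl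
    rw [hb x hx]

theorem mem_restL {i : Bool} {z : Option Bool} {w : List (Reg α)} :
    w ∈ restL i z ↔ ∃ b : List Bool, b.head? = z ∧ w = digits i b := by
  cases z with
  | none =>
    rw [restL, mem_one]
    constructor
    · rintro rfl
      exact ⟨[], rfl, rfl⟩
    · rintro ⟨b, hb, rfl⟩
      rw [List.head?_eq_none_iff.1 hb]
      rfl
  | some x =>
    constructor
    · rintro ⟨_, ⟨_, rfl, rfl⟩, w, hw, rfl⟩
      obtain ⟨b, rfl⟩ := mem_digitsL.1 hw
      exact ⟨x :: b, rfl, rfl⟩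
    · rintro ⟨b, hb, rfl⟩
      obtain ⟨b, rfl⟩ := List.head?_eq_some_iff.1 hb
      exact append_mem_mul (a := [seg i (some x)]) ⟨_, rfl, rfl⟩ (mem_digitsL.2 ⟨b, rfl⟩)

theorem singleton_mem_litL (i : Bool) (l : Option Bool) :
    [(seg i l : Reg α)] ∈ (litL i l : Language (Reg α)) := ⟨_, rfl, rfl⟩

theorem mem_anyL (w : List (Reg α)) : w ∈ anyL α := fun _ _ => trivial

/-- The label of kind `i` that a letter carries. -/
def label (i : Bool) : Reg α → Option (Option Bool)
  | seg j l => if j = i then some l else none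
  | _ => none

/-! ### Reading the labels off the register. -/

theorem filterMap_label_map_seg (i : Bool) (s : List (Option Bool)) :
    (s.map (seg i : _ → Reg α)).filterMap (label i) = s := by
  rw [List.filterMap_map]
  convert List.filterMap_some
  simp [label]

theorem filterMap_label_digits (i : Bool) (b : List Bool) :
    (digits i b : List (Reg α)).filterMap (label i) = b.map some :=
  filterMap_label_map_seg i _

theorem filterMap_label_digits_of_ne {i j : Bool} (h : j ≠ i) (b : List Bool) :
    (digits j b : List (Reg α)).filterMap (label i) = [] := by
  rw [List.filterMap_eq_nil_iff]
  intro a ha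
  obtain ⟨l, -, rfl⟩ := List.mem_map.1 ha
  simp [label, h]

theorem filterMap_label_of_mem_notSegL {i : Bool} {w : List (Reg α)} (h : w ∈ notSegL i) :
    w.filterMap (label i) = [] := by
  rw [List.filterMap_eq_nil_iff]
  intro a ha
  have := h a ha
  cases a <;> simp_all [label]

theorem filterMap_label_of_mem_blankL {i : Bool} {w : List (Reg α)} (h : w ∈ blankL α) :
    w.filterMap (label i) = [] :=
  filterMap_label_of_mem_notSegL fun a ha l h' => by
    rw [h a ha] at h'
    cases h'

theorem map_seg_mem_notSegL {i j : Bool} (hij : j ≠ i) (s : List (Option Bool)) :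
    s.map (seg j : _ → Reg α) ∈ notSegL (α := α) i := by
  intro a ha l h
  obtain ⟨l', -, rfl⟩ := List.mem_map.1 ha
  injection h with h
  exact hij h

theorem replicate_blank_mem_notSegL (i : Bool) (n : ℕ) :
    List.replicate n (blank : Reg α) ∈ notSegL (α := α) i := by
  intro a ha l h
  rw [List.eq_of_mem_replicate ha] at h
  cases h

theorem append_mem_notSegL {i : Bool} {v w : List (Reg α)} (hv : v ∈ notSegL i)
    (hw : w ∈ notSegL i) : v ++ w ∈ notSegL i :=
  fun a ha => (List.mem_append.1 ha).elim (hv a) (hw a)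

theorem filterMap_label_seg_cons (i : Bool) (l : Option Bool) (w : List (Reg α)) :
    (seg i l :: w).filterMap (label i) = l :: w.filterMap (label i) := by
  rw [List.filterMap_cons_some]
  simp [label]

/-- Extracting the labels of one kind erases everything else and turns the regular factors into the
lists of the matching constructor. The factors `notSegL` and `blankL` guarantee that the blocks in a
tail dispute are the last ones of their kind. -/
theorem IsLabelPattern.dispute {π : Pattern (Reg α)} (h : IsLabelPattern π)
    {r A P B Q C : List (Reg α)} (hr : π.Splits r A P B Q C) :
    Dispute (r.filterMap (label false)) (r.filterMap (label true)) P.length Q.length := by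
  obtain ⟨hA, hP, hB, hQ, hC, rfl⟩ := hr
  have key : ∀ {i : Bool} {r : List (Reg α)} {p q : ℕ}, SuccDispute (r.filterMap (label i)) p q →
      Dispute (r.filterMap (label false)) (r.filterMap (label true)) p q := by
    rintro (_ | _) r p q h
    · exact Or.inl h
    · exact Or.inr (Or.inl h)
  cases h with
  | carry i z y h =>
    obtain ⟨A, -, _, ⟨_, rfl, rfl⟩, rfl⟩ := hA
    obtain ⟨P, hP1, rfl⟩ := mem_onesL.1 hP
    obtain ⟨B, hB, _, ⟨_, rfl, rfl⟩, rfl⟩ := hB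
    obtain ⟨b, rfl, rfl⟩ := mem_restL.1 hB
    obtain ⟨Q, rfl⟩ := mem_digitsL.1 hQ
    obtain ⟨_, ⟨_, rfl, rfl⟩, C, -, rfl⟩ := hC
    refine key (i := i) ?_
    rw [length_digits, length_digits]
    refine ⟨A.filterMap (label i), _, _, ?_, Conflict.carry P b Q y (C.filterMap (label i)) hP1 h⟩
    simp [filterMap_label_digits, filterMap_label_seg_cons]
  | overflow i y h =>
    obtain ⟨A, -, _, ⟨_, rfl, rfl⟩, rfl⟩ := hA
    obtain ⟨P, hP1, rfl⟩ := mem_onesL.1 hP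
    obtain ⟨_, rfl, rfl⟩ := hB
    obtain ⟨Q, rfl⟩ := mem_digitsL.1 hQ
    obtain ⟨_, ⟨_, rfl, rfl⟩, _, ⟨_, ⟨_, rfl, rfl⟩, C, -, rfl⟩, rfl⟩ := hC
    refine key (i := i) ?_
    rw [length_digits, length_digits]
    refine ⟨A.filterMap (label i), _, _, ?_, Conflict.overflow P Q y (C.filterMap (label i)) hP1 h⟩
    simp [filterMap_label_digits, filterMap_label_seg_cons]
  | copy i z y h =>
    obtain ⟨A, -, _, ⟨_, rfl, rfl⟩, rfl⟩ := hA
    obtain ⟨P, hP, _, ⟨_, ⟨_, rfl, rfl⟩, P', hP', rfl⟩, rfl⟩ := hP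
    obtain ⟨P, rfl⟩ := mem_digitsL.1 hP
    obtain ⟨P', rfl⟩ := mem_digitsL.1 hP'
    obtain ⟨B, hB, _, ⟨_, rfl, rfl⟩, rfl⟩ := hB
    obtain ⟨b, rfl, rfl⟩ := mem_restL.1 hB
    obtain ⟨Q, rfl⟩ := mem_digitsL.1 hQ
    obtain ⟨_, ⟨_, rfl, rfl⟩, C, -, rfl⟩ := hC
    refine key (i := i) ?_
    have hl : (digits i P ++ ([seg i (some false)] ++ digits i P') : List (Reg α)) =
        digits i (P ++ false :: P') := by simp [digits]
    dsimp only
    rw [hl, length_digits, length_digits]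
    refine ⟨A.filterMap (label i), _, _, ?_, Conflict.copy (P ++ false :: P') b Q y
      (C.filterMap (label i)) (by simp) h⟩
    simp [filterMap_label_digits, filterMap_label_seg_cons]
  | block z z' h =>
    obtain ⟨A, -, _, ⟨_, rfl, rfl⟩, rfl⟩ := hA
    obtain ⟨P, rfl⟩ := mem_digitsL.1 hP
    obtain ⟨B, hB, _, ⟨_, ⟨_, rfl, rfl⟩, _, ⟨T, hT, _, ⟨N, hN, _, ⟨_, rfl, rfl⟩, rfl⟩, rfl⟩, rfl⟩,
      rfl⟩ := hB
    obtain ⟨b, rfl, rfl⟩ := mem_restL.1 hB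
    obtain ⟨t, rfl⟩ := mem_digitsL.1 hT
    obtain ⟨Q, rfl⟩ := mem_digitsL.1 hQ
    obtain ⟨B', hB', _, ⟨_, ⟨_, rfl, rfl⟩, _, ⟨T', hT', N', hN', rfl⟩, rfl⟩, rfl⟩ := hC
    obtain ⟨b', rfl, rfl⟩ := mem_restL.1 hB'
    obtain ⟨t', rfl⟩ := mem_digitsL.1 hT'
    rw [length_digits, length_digits]
    have := TailDispute.block (A.filterMap (label false))
      (A.filterMap (label true) ++ N.filterMap (label true)) P b t Q b' t' h
    refine Or.inr (Or.inr ?_)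
    convert this using 1
    · simp [filterMap_label_digits, filterMap_label_digits_of_ne, label,
        filterMap_label_of_mem_notSegL hN,
        filterMap_label_of_mem_blankL hN']
    · simp [filterMap_label_digits, filterMap_label_digits_of_ne, label,
        filterMap_label_of_mem_blankL hN']
  | rest z z' h =>
    obtain ⟨A, -, _, ⟨_, rfl, rfl⟩, rfl⟩ := hA
    obtain ⟨P, rfl⟩ := mem_digitsL.1 hP
    obtain ⟨B, hB, _, ⟨N, hN, _, ⟨_, rfl, rfl⟩, rfl⟩, rfl⟩ := hB
    obtain ⟨b, rfl, rfl⟩ := mem_restL.1 hB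
    obtain ⟨Q, rfl⟩ := mem_digitsL.1 hQ
    obtain ⟨B', hB', N', hN', rfl⟩ := hC
    obtain ⟨b', rfl, rfl⟩ := mem_restL.1 hB'
    rw [length_digits, length_digits]
    have := TailDispute.rest (A.filterMap (label false))
      (A.filterMap (label true) ++ N.filterMap (label true)) P b Q b' h
    refine Or.inr (Or.inr ?_)
    convert this using 1
    · simp [filterMap_label_digits, filterMap_label_digits_of_ne, label,
        filterMap_label_of_mem_notSegL hN,
        filterMap_label_of_mem_blankL hN']
    · simp [filterMap_label_digits, filterMap_label_digits_of_ne, label,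
        filterMap_label_of_mem_blankL hN']

theorem filterMap_label_replicate_blank (i : Bool) (n : ℕ) :
    (List.replicate n (blank : Reg α)).filterMap (label i) = [] :=
  filterMap_label_of_mem_notSegL (replicate_blank_mem_notSegL i n)

theorem filterMap_label_frame (a : ℕ) (s : List (Option Bool)) (b : ℕ) (s' : List (Option Bool))
    (c : ℕ) : (frame a s b s' c : List (Reg α)).filterMap (label false) = s ∧
      (frame a s b s' c : List (Reg α)).filterMap (label true) = s' := by
  have h1 := filterMap_label_of_mem_notSegL
    (map_seg_mem_notSegL (α := α) (i := false) (j := true) (by simp) s')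
  have h2 := filterMap_label_of_mem_notSegL
    (map_seg_mem_notSegL (α := α) (i := true) (j := false) (by simp) s)
  simp only [frame, List.filterMap_append, filterMap_label_replicate_blank,
    filterMap_label_map_seg, h1, h2]
  simp

theorem occurs_of_succDispute (i : Bool) (u v : List (Reg α)) {s : List (Option Bool)} {p q : ℕ}
    (h : SuccDispute s p q) :
    Occurs {π | IsLabelPattern π} (u ++ (s.map (seg i) ++ v)) p q := by
  obtain ⟨α', c, ρ, rfl, h⟩ := h
  have hA : u ++ α'.map (seg i) ++ [seg i none] ∈ anyL α * litL i none :=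
    append_mem_mul (mem_anyL _) (singleton_mem_litL i none)
  cases h with
  | carry P b Q y ρ hP hy =>
    exact ⟨_, IsLabelPattern.carry i b.head? y hy, _, digits i P, digits i b ++ [seg i none],
      digits i Q, [seg i y] ++ (ρ.map (seg i) ++ v), ⟨hA, mem_onesL.2 ⟨P, hP, rfl⟩,
      append_mem_mul (mem_restL.2 ⟨b, rfl, rfl⟩) (singleton_mem_litL i none),
      mem_digitsL.2 ⟨Q, rfl⟩, append_mem_mul (singleton_mem_litL i y) (mem_anyL _),
      by simp [digits]⟩, length_digits i P, length_digits i Q⟩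
  | overflow P Q y ρ hP hy =>
    exact ⟨_, IsLabelPattern.overflow i y hy, _, digits i c, [seg i none],
      digits i Q, [seg i (some false)] ++ ([seg i y] ++ (ρ.map (seg i) ++ v)),
      ⟨hA, mem_onesL.2 ⟨c, hP, rfl⟩, singleton_mem_litL i none,
      mem_digitsL.2 ⟨Q, rfl⟩, append_mem_mul (singleton_mem_litL i (some false))
      (append_mem_mul (singleton_mem_litL i y) (mem_anyL _)),
      by simp [digits]⟩, length_digits i c, length_digits i Q⟩
  | copy P b Q y ρ hP hy =>
    refine ⟨_, IsLabelPattern.copy i b.head? y hy, _, digits i P, digits i b ++ [seg i none],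
      digits i Q, [seg i y] ++ (ρ.map (seg i) ++ v), ⟨hA, ?_,
      append_mem_mul (mem_restL.2 ⟨b, rfl, rfl⟩) (singleton_mem_litL i none),
      mem_digitsL.2 ⟨Q, rfl⟩, append_mem_mul (singleton_mem_litL i y) (mem_anyL _),
      by simp [digits]⟩, length_digits i P, length_digits i Q⟩
    obtain ⟨P₁, P₂, rfl⟩ := List.append_of_mem hP
    exact ⟨digits i P₁, mem_digitsL.2 ⟨P₁, rfl⟩, [seg i (some false)] ++ digits i P₂,
      append_mem_mul (singleton_mem_litL i _) (mem_digitsL.2 ⟨P₂, rfl⟩), by simp [digits]⟩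

theorem occurs_frame_iff {a : ℕ} {s : List (Option Bool)} {b : ℕ} {s' : List (Option Bool)}
    {c p q : ℕ} : Occurs {π : Pattern (Reg α) | IsLabelPattern π} (frame a s b s' c) p q ↔
      Dispute s s' p q := by
  constructor
  · rintro ⟨π, hπ, A, P, B, Q, C, h, rfl, rfl⟩
    have := hπ.dispute h
    rwa [(filterMap_label_frame a s b s' c).1, (filterMap_label_frame a s b s' c).2] at this
  · rintro (h | h | h)
    · exact occurs_of_succDispute false _ _ h
    · have := occurs_of_succDispute true (List.replicate a (blank : Reg α) ++ (s.map (seg false) ++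
        List.replicate b blank)) (List.replicate c blank) h
      simpa [frame] using this
    · cases h with
      | block β β' P d t Q d' t' h =>
        refine ⟨_, IsLabelPattern.block d.head? d'.head? h,
          (List.replicate a blank ++ β.map (seg false)) ++ [seg false none], digits false P,
          digits false d ++ ([seg false none] ++ (digits false t ++
            ((List.replicate b blank ++ β'.map (seg true)) ++ [seg true none]))),
          digits true Q, digits true d' ++ ([seg true none] ++ (digits true t' ++
            List.replicate c blank)), ⟨?_, mem_digitsL.2 ⟨P, rfl⟩, ?_, mem_digitsL.2 ⟨Q, rfl⟩, ?_,
          by simp [digits, frame]⟩, length_digits _ P, length_digits _ Q⟩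
        · exact append_mem_mul (mem_anyL _) (singleton_mem_litL _ _)
        · exact append_mem_mul (mem_restL.2 ⟨d, rfl, rfl⟩) (append_mem_mul
            (singleton_mem_litL _ _) (append_mem_mul (mem_digitsL.2 ⟨t, rfl⟩) (append_mem_mul
            (append_mem_notSegL (replicate_blank_mem_notSegL _ _)
              (map_seg_mem_notSegL (by simp) _)) (singleton_mem_litL _ _))))
        · exact append_mem_mul (mem_restL.2 ⟨d', rfl, rfl⟩) (append_mem_mul
            (singleton_mem_litL _ _) (append_mem_mul (mem_digitsL.2 ⟨t', rfl⟩)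
            (fun _ => List.eq_of_mem_replicate)))
      | rest β β' P d Q d' h =>
        refine ⟨_, IsLabelPattern.rest d.head? d'.head? h,
          (List.replicate a blank ++ β.map (seg false)) ++ [seg false none], digits false P,
          digits false d ++ ((List.replicate b blank ++ β'.map (seg true)) ++ [seg true none]),
          digits true Q, digits true d' ++ List.replicate c blank, ⟨?_, mem_digitsL.2 ⟨P, rfl⟩, ?_,
          mem_digitsL.2 ⟨Q, rfl⟩, ?_, by simp [digits, frame]⟩, length_digits _ P,
          length_digits _ Q⟩
        · exact append_mem_mul (mem_anyL _) (singleton_mem_litL _ _)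
        · exact append_mem_mul (mem_restL.2 ⟨d, rfl, rfl⟩) (append_mem_mul
            (append_mem_notSegL (replicate_blank_mem_notSegL _ _)
              (map_seg_mem_notSegL (by simp) _)) (singleton_mem_litL _ _))
        · exact append_mem_mul (mem_restL.2 ⟨d', rfl, rfl⟩) (fun _ => List.eq_of_mem_replicate)

/-- Disputes are only about registers with a label. -/
theorem exists_seg_mem_of_occurs {r : List (Reg α)} {p q : ℕ}
    (h : Occurs {π : Pattern (Reg α) | IsLabelPattern π} r p q) : ∃ i l, seg i l ∈ r := by
  obtain ⟨π, hπ, A, P, B, Q, C, ⟨hA, -, -, -, -, rfl⟩, -⟩ := h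
  suffices h : ∃ i, A ∈ anyL α * litL i none by
    obtain ⟨i, A, -, _, ⟨_, rfl, rfl⟩, rfl⟩ := h
    exact ⟨i, none, by simp⟩
  cases hπ <;> exact ⟨_, hA⟩

end Reg

/-! ### The iterated logarithm -/

/-- The iterated powers of two. -/
def tower : ℕ → ℕ
  | 0 => 1
  | k + 1 => 2 ^ tower k

theorem lt_tower (k : ℕ) : k < tower k := by
  induction k with
  | zero => exact Nat.one_pos
  | succ k ih => exact (Nat.succ_le_of_lt ih).trans_lt Nat.lt_two_pow_self

theorem le_tower_of_iterate_logb_le {k : ℕ} {x : ℝ} (h : (Real.logb 2)^[k] x ≤ 1) :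
    x ≤ tower k := by
  induction k generalizing x with
  | zero => simpa [tower] using h
  | succ k ih =>
    rw [Function.iterate_succ_apply] at h
    -- The logarithm is meaningful only for positive arguments; otherwise the bound is trivial.
    rcases le_or_gt x 0 with hx | hx
    · exact hx.trans (Nat.cast_nonneg _)
    · have := (Real.logb_le_iff_le_rpow one_lt_two hx).1 (ih h)
      rw [tower]
      push_cast
      rwa [Real.rpow_natCast] at this

theorem exists_iterate_logb_le {k : ℕ} {x : ℝ} (h : x ≤ tower k) :
    ∃ j, (Real.logb 2)^[j] x ≤ 1 := by
  induction k generalizing x with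
  | zero => exact ⟨0, by simpa [tower] using h⟩
  | succ k ih =>
    rcases le_or_gt x 0 with hx | hx
    · exact ⟨0, hx.trans zero_le_one⟩
    · rw [tower] at h
      push_cast at h
      rw [← Real.rpow_natCast] at h
      obtain ⟨j, hj⟩ := ih ((Real.logb_le_iff_le_rpow one_lt_two hx).2 h)
      exact ⟨j + 1, by rwa [Function.iterate_succ_apply]⟩

theorem le_tower_logStar (n : ℕ) : n ≤ tower (logStar n) := by
  -- The set must be shown nonempty, since `sInf ∅` is 0 by default.
  have h : (logStar n) ∈ {k : ℕ | (Real.logb 2)^[k] (n : ℝ) ≤ 1} :=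
    Nat.sInf_mem (exists_iterate_logb_le (Nat.cast_le.2 (lt_tower n).le))
  exact_mod_cast le_tower_of_iterate_logb_le h

/-! ### The form of the input -/

namespace PadSym

variable {α : Type u}

/-- The word `w` has the form `u' $ v'` with `u'` in `#* u #*` and `v'` in `#* v #*`. -/
def Encodes (w : List (PadSym α)) (u v : List α) : Prop :=
  ∃ a b c d, w = List.replicate a hash ++ (u.map letter ++ (List.replicate b hash ++ ([dollar] ++
    (List.replicate c hash ++ (v.map letter ++ List.replicate d hash)))))

theorem mem_kstar_hash {w : List (PadSym α)} :
    w ∈ (({[hash]} : Language (PadSym α))∗) ↔ ∃ n, w = List.replicate n hash := by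
  rw [mem_kstar]
  constructor
  · rintro ⟨L, rfl, h⟩
    refine ⟨L.length, ?_⟩
    rw [List.eq_replicate_iff.2 ⟨rfl, fun b hb => h b hb⟩]
    simp
  · rintro ⟨n, rfl⟩
    exact ⟨List.replicate n [hash], by simp, fun y hy => List.eq_of_mem_replicate hy⟩

theorem mem_padded {u : List α} {w : List (PadSym α)} : w ∈ padded u ↔
    ∃ a b, w = List.replicate a hash ++ u.map letter ++ List.replicate b hash := by
  rw [padded, mem_mul]
  constructor
  · rintro ⟨_, ⟨x, hx, _, rfl, rfl⟩, y, hy, rfl⟩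
    obtain ⟨a, rfl⟩ := mem_kstar_hash.1 hx
    obtain ⟨b, rfl⟩ := mem_kstar_hash.1 hy
    exact ⟨a, b, rfl⟩
  · rintro ⟨a, b, rfl⟩
    exact ⟨_, append_mem_mul (mem_kstar_hash.2 ⟨a, rfl⟩) rfl, _, mem_kstar_hash.2 ⟨b, rfl⟩, rfl⟩

theorem encodes_iff {w : List (PadSym α)} {u v : List α} :
    Encodes w u v ↔ ∃ u' ∈ padded u, ∃ v' ∈ padded v, w = u' ++ [dollar] ++ v' := by
  constructor
  · rintro ⟨a, b, c, d, rfl⟩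
    exact ⟨_, mem_padded.2 ⟨a, b, rfl⟩, _, mem_padded.2 ⟨c, d, rfl⟩, by simp⟩
  · rintro ⟨u', hu, v', hv, rfl⟩
    obtain ⟨a, b, rfl⟩ := mem_padded.1 hu
    obtain ⟨c, d, rfl⟩ := mem_padded.1 hv
    exact ⟨a, b, c, d, by simp⟩

theorem mem_eqLanguage {w : List (PadSym α)} :
    w ∈ eqLanguage α ↔ ∃ u v, Encodes w u v ∧ u = v := by
  simp only [encodes_iff]
  constructor
  · rintro ⟨u, v, u', hu, v', hv, h, huv⟩
    exact ⟨u, v, ⟨u', hu, v', hv, h⟩, huv⟩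
  · rintro ⟨u, v, ⟨u', hu, v', hv, h⟩, huv⟩
    exact ⟨u, v, u', hu, v', hv, h, huv⟩

theorem mem_neLanguage {w : List (PadSym α)} :
    w ∈ neLanguage α ↔ ∃ u v, Encodes w u v ∧ u ≠ v := by
  simp only [encodes_iff]
  constructor
  · rintro ⟨u, v, u', hu, v', hv, h, huv⟩
    exact ⟨u, v, ⟨u', hu, v', hv, h⟩, huv⟩
  · rintro ⟨u, v, ⟨u', hu, v', hv, h⟩, huv⟩
    exact ⟨u, v, u', hu, v', hv, h, huv⟩

/-- Whether a letter is not the separator `$`. -/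
def notDollar : PadSym α → Bool
  | dollar => false
  | _ => true

/-- The letter of the original alphabet, if there is one. -/
def letter? : PadSym α → Option α
  | letter a => some a
  | _ => none

theorem filterMap_letter_map (u : List α) : (u.map letter).filterMap letter? = u := by
  rw [List.filterMap_map]
  exact List.filterMap_some

theorem filterMap_letter_replicate (n : ℕ) :
    (List.replicate n (hash : PadSym α)).filterMap letter? = [] := by
  rw [List.filterMap_eq_nil_iff]
  intro a ha
  rw [List.eq_of_mem_replicate ha]
  rfl

theorem Encodes.eq {w : List (PadSym α)} {u v : List α} (h : Encodes w u v) :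
    u = (w.takeWhile notDollar).filterMap letter? ∧
      v = (w.dropWhile notDollar).filterMap letter? := by
  obtain ⟨a, b, c, d, rfl⟩ := h
  have h1 : ∀ n, ∀ x ∈ List.replicate n (hash : PadSym α), notDollar x = true := fun n x hx => by
    rw [List.eq_of_mem_replicate hx]
    rfl
  have h2 : ∀ u : List α, ∀ x ∈ u.map letter, notDollar x = true := fun u x hx => by
    obtain ⟨y, -, rfl⟩ := List.mem_map.1 hx
    rfl
  rw [List.takeWhile_append_of_pos (h1 a), List.takeWhile_append_of_pos (h2 u),
    List.takeWhile_append_of_pos (h1 b), List.dropWhile_append_of_pos (h1 a),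
    List.dropWhile_append_of_pos (h2 u), List.dropWhile_append_of_pos (h1 b)]
  have h3 : ∀ t, ([dollar] ++ t : List (PadSym α)).takeWhile notDollar = [] := fun _ => rfl
  have h4 : ∀ t, ([dollar] ++ t : List (PadSym α)).dropWhile notDollar = [dollar] ++ t :=
    fun _ => rfl
  have h5 : ([dollar] : List (PadSym α)).filterMap letter? = [] := rfl
  simp only [h3, h4, h5, List.filterMap_append, filterMap_letter_map, filterMap_letter_replicate,
    List.append_nil, List.nil_append, and_self]

/-- A single encoding therefore decides membership: equal words in one encoding rule out different
words in another. -/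
theorem Encodes.unique {w : List (PadSym α)} {u v u' v' : List α} (h : Encodes w u v)
    (h' : Encodes w u' v') : u = u' ∧ v = v' :=
  ⟨h.eq.1.trans h'.eq.1.symm, h.eq.2.trans h'.eq.2.symm⟩

end PadSym

/-! ### Disputes about the input -/

namespace Reg

variable {α : Type u}

open PadSym

theorem input_injective : Function.Injective (input : PadSym α → Reg α) := fun _ _ h => by
  injection h

/-- The words that consist of the symbol `#`. -/
def hashL (α : Type u) : Language (Reg α) := allL (· = input hash)

/-- The words that consist of the symbol `$`. -/
def dollarL (α : Type u) : Language (Reg α) := oneL (· = input dollar)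

/-- The words over the original alphabet. -/
def lettersL (α : Type u) : Language (Reg α) := allL fun x => ∃ a, x = input (letter a)

/-- The words over the original alphabet that start with `z`; the empty word if `z` is `none`. -/
def headL : Option α → Language (Reg α)
  | none => 1
  | some a => oneL (· = input (letter a)) * lettersL α

/-- The form of disputes about the equality of two words in which the next letters are `z` and
`z'`. -/
def inputPattern (z z' : Option α) : Pattern (Reg α) :=
  ⟨hashL α, lettersL α, headL z * (hashL α * (dollarL α * hashL α)), lettersL α,
    headL z' * hashL α⟩

/-- The words of the form `u' $ v'`. -/
def formatL (α : Type u) : Language (Reg α) :=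
  hashL α * (lettersL α * (hashL α * (dollarL α * (hashL α * (lettersL α * hashL α)))))

theorem isRegular_hashL : (hashL α).IsRegular := isRegular_allL _

theorem isRegular_dollarL : (dollarL α).IsRegular := isRegular_oneL _

theorem isRegular_lettersL : (lettersL α).IsRegular := isRegular_allL _

theorem isRegular_headL (z : Option α) : (headL z).IsRegular := by
  cases z with
  | none => exact isRegular_one
  | some a => exact (isRegular_oneL _).mul isRegular_lettersL

theorem isRegular_inputPattern (z z' : Option α) : (inputPattern z z').IsRegular :=
  ⟨isRegular_hashL, isRegular_lettersL, (isRegular_headL z).mul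
    (isRegular_hashL.mul (isRegular_dollarL.mul isRegular_hashL)), isRegular_lettersL,
    (isRegular_headL z').mul isRegular_hashL⟩

theorem isRegular_formatL : (formatL α).IsRegular :=
  isRegular_hashL.mul (isRegular_lettersL.mul (isRegular_hashL.mul (isRegular_dollarL.mul
    (isRegular_hashL.mul (isRegular_lettersL.mul isRegular_hashL)))))

theorem mem_hashL {w : List (Reg α)} :
    w ∈ hashL α ↔ ∃ n, w = (List.replicate n hash).map input := by
  simp only [List.map_replicate]
  exact ⟨fun h => ⟨w.length, List.eq_replicate_iff.2 ⟨rfl, h⟩⟩, fun ⟨n, h⟩ a ha =>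
    List.eq_of_mem_replicate (h ▸ ha)⟩

theorem mem_lettersL {w : List (Reg α)} :
    w ∈ lettersL α ↔ ∃ u : List α, w = (u.map letter).map input := by
  constructor
  · intro h
    induction w with
    | nil => exact ⟨[], rfl⟩
    | cons x w ih =>
      obtain ⟨⟨a, rfl⟩, h'⟩ := List.forall_mem_cons.1 h
      obtain ⟨u, rfl⟩ := ih h'
      exact ⟨a :: u, rfl⟩
  · rintro ⟨u, rfl⟩ x hx
    obtain ⟨y, hy, rfl⟩ := List.mem_map.1 hx
    obtain ⟨a, -, rfl⟩ := List.mem_map.1 hy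
    exact ⟨a, rfl⟩

theorem mem_headL {z : Option α} {w : List (Reg α)} :
    w ∈ headL z ↔ ∃ u : List α, u.head? = z ∧ w = (u.map letter).map input := by
  cases z with
  | none =>
    rw [headL, mem_one]
    constructor
    · rintro rfl
      exact ⟨[], rfl, rfl⟩
    · rintro ⟨u, hu, rfl⟩
      rw [List.head?_eq_none_iff.1 hu]
      rfl
  | some a =>
    constructor
    · rintro ⟨_, ⟨_, rfl, rfl⟩, w, hw, rfl⟩
      obtain ⟨u, rfl⟩ := mem_lettersL.1 hw
      exact ⟨a :: u, rfl, rfl⟩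
    · rintro ⟨u, hu, rfl⟩
      obtain ⟨u, rfl⟩ := List.head?_eq_some_iff.1 hu
      exact append_mem_mul (a := [input (letter a)]) ⟨_, rfl, rfl⟩ (mem_lettersL.2 ⟨u, rfl⟩)

theorem dollar_mem_dollarL : [input dollar] ∈ dollarL α := ⟨_, rfl, rfl⟩

theorem map_input_mem_formatL {w : List (PadSym α)} :
    w.map input ∈ formatL α ↔ ∃ u v, Encodes w u v := by
  constructor
  · rintro ⟨_, h1, _, ⟨_, h2, _, ⟨_, h3, _, ⟨_, ⟨_, rfl, rfl⟩, _, ⟨_, h4, _, ⟨_, h5, _, h6, rfl⟩,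
      rfl⟩, rfl⟩, rfl⟩, rfl⟩, h⟩
    obtain ⟨a, rfl⟩ := mem_hashL.1 h1
    obtain ⟨u, rfl⟩ := mem_lettersL.1 h2
    obtain ⟨b, rfl⟩ := mem_hashL.1 h3
    obtain ⟨c, rfl⟩ := mem_hashL.1 h4
    obtain ⟨v, rfl⟩ := mem_lettersL.1 h5
    obtain ⟨d, rfl⟩ := mem_hashL.1 h6
    refine ⟨u, v, a, b, c, d, input_injective.list_map (h.symm.trans ?_)⟩
    simp
  · rintro ⟨u, v, a, b, c, d, rfl⟩
    simp only [List.map_append (f := input)]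
    exact append_mem_mul (mem_hashL.2 ⟨a, rfl⟩) (append_mem_mul (mem_lettersL.2 ⟨u, rfl⟩)
      (append_mem_mul (mem_hashL.2 ⟨b, rfl⟩) (append_mem_mul dollar_mem_dollarL
      (append_mem_mul (mem_hashL.2 ⟨c, rfl⟩) (append_mem_mul (mem_lettersL.2 ⟨v, rfl⟩)
      (mem_hashL.2 ⟨d, rfl⟩))))))

/-- The forms of disputes about the equality of the two words in the input. -/
def inputPatterns (α : Type u) : Set (Pattern (Reg α)) :=
  {π | ∃ z z', z ≠ z' ∧ π = inputPattern z z'}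

theorem finite_inputPatterns [Finite α] : (inputPatterns α).Finite := by
  refine (Set.finite_range fun x : Option α × Option α => inputPattern x.1 x.2).subset ?_
  rintro _ ⟨z, z', -, rfl⟩
  exact ⟨(z, z'), rfl⟩

theorem exists_encodes_of_occurs {w : List (PadSym α)} {p q : ℕ}
    (h : Occurs (inputPatterns α) (w.map input) p q) :
    ∃ P b Q b', Encodes w (P ++ b) (Q ++ b') ∧ b.head? ≠ b'.head? ∧ P.length = p ∧
      Q.length = q := by
  obtain ⟨_, ⟨z, z', hz, rfl⟩, _, _, _, _, _, ⟨hA, hP, ⟨_, hb, _, ⟨_, h1, _, ⟨_, ⟨_, rfl, rfl⟩, _,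
    h2, rfl⟩, rfl⟩, rfl⟩, hQ, ⟨_, hb', _, h3, rfl⟩, h⟩, rfl, rfl⟩ := h
  obtain ⟨a, rfl⟩ := mem_hashL.1 hA
  obtain ⟨P, rfl⟩ := mem_lettersL.1 hP
  obtain ⟨b, rfl, rfl⟩ := mem_headL.1 hb
  obtain ⟨n, rfl⟩ := mem_hashL.1 h1
  obtain ⟨c, rfl⟩ := mem_hashL.1 h2
  obtain ⟨Q, rfl⟩ := mem_lettersL.1 hQ
  obtain ⟨b', rfl, rfl⟩ := mem_headL.1 hb'
  obtain ⟨d, rfl⟩ := mem_hashL.1 h3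
  refine ⟨P, b, Q, b', ⟨a, n, c, d, input_injective.list_map (h.trans ?_)⟩, hz, by simp, by simp⟩
  simp

theorem exists_occurs_of_encodes {w : List (PadSym α)} {u v : List α} (h : Encodes w u v)
    (huv : u ≠ v) : ∃ p ≤ w.length, Occurs (inputPatterns α) (w.map input) p p := by
  obtain ⟨P, b, b', rfl, rfl, hb⟩ := exists_common_prefix huv
  obtain ⟨a, n, c, d, rfl⟩ := h
  refine ⟨P.length, ?_, _, ⟨b.head?, b'.head?, hb, rfl⟩, (List.replicate a hash).map input,
    (P.map letter).map input, (b.map letter).map input ++ ((List.replicate n hash).map input ++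
    ([input dollar] ++ (List.replicate c hash).map input)), (P.map letter).map input,
    (b'.map letter).map input ++ (List.replicate d hash).map input, ⟨mem_hashL.2 ⟨a, rfl⟩,
    mem_lettersL.2 ⟨P, rfl⟩, append_mem_mul (mem_headL.2 ⟨b, rfl, rfl⟩) (append_mem_mul
    (mem_hashL.2 ⟨n, rfl⟩) (append_mem_mul dollar_mem_dollarL (mem_hashL.2 ⟨c, rfl⟩))),
    mem_lettersL.2 ⟨P, rfl⟩, append_mem_mul (mem_headL.2 ⟨b', rfl, rfl⟩) (mem_hashL.2 ⟨d, rfl⟩),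
    by simp⟩, by simp, by simp⟩
  simp only [List.length_append, List.length_map]
  omega

theorem dollar_mem_of_occurs {r : List (Reg α)} {p q : ℕ} (h : Occurs (inputPatterns α) r p q) :
    input dollar ∈ r := by
  obtain ⟨_, ⟨z, z', hz, rfl⟩, _, _, _, _, _, ⟨-, -, ⟨_, hb, _, ⟨_, h1, _, ⟨_, ⟨_, rfl, rfl⟩, _,
    h2, rfl⟩, rfl⟩, rfl⟩, -, -, rfl⟩, -⟩ := h
  simp

theorem dollar_mem_of_mem_formatL {r : List (Reg α)} (h : r ∈ formatL α) : input dollar ∈ r := by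
  obtain ⟨_, h1, _, ⟨_, h2, _, ⟨_, h3, _, ⟨_, ⟨_, rfl, rfl⟩, _, -, rfl⟩, rfl⟩, rfl⟩, rfl⟩ := h
  simp

end Reg

/-! ### The machines -/

namespace Reg

variable {α : Type u}

open PadSym

/-- A player accepts that the input has the form `u' $ v'`. -/
def checkMove (α : Type u) : Set (List (Reg α) × List (Reg α)) :=
  {p | p.1 ∈ formatL α ∧ p.1 = p.2}

/-- The instructions about the input: when `e` is true, Anke claims that the two words are equal and
Boris may dispute this; otherwise Anke disputes it. -/
def inputMoves (α : Type u) : Bool → Player → Set (Set (List (Reg α) × List (Reg α)))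
  | true, .anke => {checkMove α}
  | true, .boris => disputeMoves (inputPatterns α)
  | false, .anke => disputeMoves (inputPatterns α)
  | false, .boris => ∅

/-- The instructions of a player. -/
def moves (α : Type u) (e : Bool) (p : Player) : Set (Set (List (Reg α) × List (Reg α))) :=
  inputMoves α e p ∪ ({resignMove α, acceptMove α} ∪ disputeMoves {π | IsLabelPattern π})

theorem finite_moves [Finite α] (e : Bool) (p : Player) : (moves α e p).Finite := by
  refine Set.Finite.union ?_ ((Set.toFinite _).union
    (finite_disputeMoves (finite_setOf_isLabelPattern α)))
  cases e <;> cases p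
  · exact finite_disputeMoves finite_inputPatterns
  · exact Set.finite_empty
  · exact Set.finite_singleton _
  · exact finite_disputeMoves finite_inputPatterns

theorem isSyncRegular_of_mem_moves {e : Bool} {p : Player}
    {J : Set (List (Reg α) × List (Reg α))} (hJ : J ∈ moves α e p) : IsSyncRegular J := by
  have hI : ∀ π ∈ inputPatterns α, π.IsRegular := by
    rintro _ ⟨z, z', -, rfl⟩
    exact isRegular_inputPattern z z'
  rcases hJ with hJ | (rfl | rfl) | hJ
  · cases e <;> cases p
    · exact isSyncRegular_of_mem_disputeMoves hI hJ
    · exact absurd hJ (Set.notMem_empty J)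
    · obtain rfl := Set.mem_singleton_iff.1 hJ
      exact IsSyncRegular.diag isRegular_formatL
    · exact isSyncRegular_of_mem_disputeMoves hI hJ
  · exact isSyncRegular_resignMove
  · exact isSyncRegular_acceptMove
  · exact isSyncRegular_of_mem_disputeMoves (fun π hπ => hπ.isRegular) hJ

/-- The machine in which Anke claims that the two words in the input are equal, if `e` is true, and
that they are different, if `e` is false. -/
abbrev machine (α : Type u) [Finite α] (e : Bool) : AARM (PadSym α) where
  Γ := Reg α
  finite_Γ := inferInstance
  incl := ⟨input, input_injective⟩
  instrs := moves α e
  finite_instrs := finite_moves e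
  automatic _ _ hJ := (isSyncRegular_of_mem_moves hJ).isAutomatic
  bounded _ _ hJ := (isSyncRegular_of_mem_moves hJ).isBoundedRel

/-- Labelling and resigning erase the `$`, so this confines the instructions about the input to the
opening of the game. -/
theorem dollar_mem_of_mem_inputMoves {e : Bool} {p : Player}
    {J : Set (List (Reg α) × List (Reg α))} (hJ : J ∈ inputMoves α e p) {r x : List (Reg α)}
    (hx : (r, x) ∈ J) : input dollar ∈ r := by
  have key : J ∈ disputeMoves (inputPatterns α) → input dollar ∈ r := fun hJ => by
    rcases of_mem_disputeMoves hJ hx with ⟨⟨p, h⟩, -⟩ | ⟨_, _, _, _, _, h, -⟩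
    · exact dollar_mem_of_occurs h
    · exact dollar_mem_of_occurs h
  cases e <;> cases p
  · exact key hJ
  · exact absurd hJ (Set.notMem_empty J)
  · obtain rfl := Set.mem_singleton_iff.1 hJ
    exact dollar_mem_of_mem_formatL hx.1
  · exact key hJ

theorem exists_seg_mem_of_mem_disputeMoves {J : Set (List (Reg α) × List (Reg α))}
    (hJ : J ∈ disputeMoves {π | IsLabelPattern π}) {r x : List (Reg α)} (hx : (r, x) ∈ J) :
    ∃ i l, seg i l ∈ r := by
  rcases of_mem_disputeMoves hJ hx with ⟨⟨p, h⟩, -⟩ | ⟨_, _, _, _, _, h, -⟩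
  · exact exists_seg_mem_of_occurs h
  · exact exists_seg_mem_of_occurs h

theorem mem_frame {x : Reg α} {a : ℕ} {s : List (Option Bool)} {b : ℕ} {s' : List (Option Bool)}
    {c : ℕ} (hx : x ∈ frame a s b s' c) : x = blank ∨ ∃ i l, x = seg i l := by
  simp only [frame, List.mem_append, List.mem_replicate, List.mem_map] at hx
  rcases hx with ⟨-, h⟩ | ⟨l, -, rfl⟩ | ⟨-, h⟩ | ⟨l, -, rfl⟩ | ⟨-, h⟩
  · exact Or.inl h
  · exact Or.inr ⟨_, l, rfl⟩
  · exact Or.inl h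
  · exact Or.inr ⟨_, l, rfl⟩
  · exact Or.inl h

theorem mem_map_input {w : List (PadSym α)} {x : Reg α} (hx : x ∈ w.map input) :
    ∃ a, x = input a := by
  obtain ⟨a, -, rfl⟩ := List.mem_map.1 hx
  exact ⟨a, rfl⟩

variable {e : Bool} {p : Player} {G : Player → Prop}

/-- Disputes need a `$` or a label and resigning needs a live first letter, so only acceptance
remains. -/
theorem eq_dead_of_mem_moves {J : Set (List (Reg α) × List (Reg α))}
    (hJ : J ∈ moves α e p) {r x : List (Reg α)} (hr : ∀ a ∈ r, a = resign ∨ a = dead)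
    (hx : (r, x) ∈ J) : (∃ t, r = resign :: t) ∧ x = List.replicate r.length dead := by
  rcases hJ with hJ | (rfl | rfl) | hJ
  · have := hr _ (dollar_mem_of_mem_inputMoves hJ hx)
    simp at this
  · obtain ⟨⟨a, t, rfl, ha⟩, -⟩ := mem_resignMove.1 hx
    exact absurd (hr a List.mem_cons_self) (not_or.2 ha)
  · exact mem_acceptMove.1 hx
  · obtain ⟨i, l, h⟩ := exists_seg_mem_of_mem_disputeMoves hJ hx
    have := hr _ h
    simp at this

variable [Finite α]

/-! ### Outcomes of the positions. -/

theorem forces_dead {q : Player} (hG : G q) (n t : ℕ) :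
    (machine α e).Forces p G t q (List.replicate n dead) := by
  refine AARM.Forces.of_stuck hG ?_ t
  rintro ⟨⟨J, x⟩, hJ, hx⟩
  obtain ⟨⟨t, ht⟩, -⟩ := eq_dead_of_mem_moves hJ
    (fun a ha => Or.inr (List.eq_of_mem_replicate ha)) hx
  have h : (resign : Reg α) ∈ List.replicate n dead := ht ▸ List.mem_cons_self
  cases List.eq_of_mem_replicate h

/-- A resignation must not produce a dead register directly, for then the opponent would be stuck
and lose. Accepting it passes the dead register back to the player who resigned. -/
theorem forces_resign (hG : G p.other) {r : List (Reg α)} (hr : r ≠ []) (t : ℕ) :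
    (machine α e).Forces p G (t + 1) p (List.replicate r.length resign) := by
  obtain ⟨a, r, rfl⟩ := List.exists_cons_of_ne_nil hr
  exact AARM.Forces.of_move (M := machine α e) (Or.inr (Or.inl (Or.inr rfl)))
    (mem_acceptMove.2 ⟨⟨List.replicate r.length resign, rfl⟩, rfl⟩)
    (by rw [List.length_replicate]; exact forces_dead hG _ _)

/-- A resignation and its acceptance take two turns, whence the offset 2; only the real moves remain
to be examined. -/
theorem forces_of_forall (hG : G p.other) {r : List (Reg α)} {t : ℕ}
    (hr : ∀ a ∈ r, a ≠ resign)
    (hi : ∀ J ∈ inputMoves α e p.other, ∀ x, (r, x) ∈ J → (machine α e).Forces p G (t + 1) p x)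
    (hd : ∀ J ∈ disputeMoves {π : Pattern (Reg α) | IsLabelPattern π}, ∀ x, (r, x) ∈ J →
      (machine α e).Forces p G (t + 1) p x) :
    (machine α e).Forces p G (t + 2) p.other r := by
  refine AARM.Forces.of_forall hG fun J hJ x hx => ?_
  rcases hJ with hJ | (rfl | rfl) | hJ
  · exact hi J hJ x hx
  · obtain ⟨⟨a, u, hu, -⟩, rfl⟩ := mem_resignMove.1 hx
    exact forces_resign hG (by rw [hu]; simp) t
  · obtain ⟨⟨u, rfl⟩, -⟩ := mem_acceptMove.1 hx
    exact absurd rfl (hr resign List.mem_cons_self)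
  · exact hd J hJ x hx

/-- The outcome of the game after a claim, according to whether it is true: if it is true, then the
player `p` who made it wins; if it is false, then the player `p` whose turn it is wins. -/
theorem forces_frame (hG : G p.other) (k : ℕ) :
    (∀ a s b c, IsCount s → s.length ≤ tower k →
      (machine α e).Forces p G (k + 2) p.other (frame a s b s c)) ∧
    ∀ a s b s' c, (∃ t, s = none :: none :: t) → (∃ t, s' = none :: none :: t) →
      s.length ≠ s'.length → s.length ≤ tower k → s'.length ≤ tower k →
      (machine α e).Forces p G (k + 2) p (frame a s b s' c) := by
  -- One turn descends one level of the tower. Level 0 cannot occur, since labelled factors have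
  -- length at least 2.
  have ht : ∀ {k n : ℕ}, 2 ≤ n → 2 ^ n ≤ tower k → ∃ k', k = k' + 1 ∧ n ≤ tower k' := by
    rintro (_ | k) n hn h
    · have : 2 ^ 2 ≤ 2 ^ n := Nat.pow_le_pow_right two_pos hn
      simp only [tower] at h
      omega
    · exact ⟨k, rfl, (Nat.pow_le_pow_iff_right one_lt_two).1 h⟩
  induction k using Nat.strong_induction_on with
  | _ k ih =>
    constructor
    · intro a s b c hs hl
      refine forces_of_forall hG ?_ ?_ ?_
      · intro x hx
        rcases mem_frame hx with rfl | ⟨i, l, rfl⟩ <;> simp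
      · intro J hJ x hx
        rcases mem_frame (dollar_mem_of_mem_inputMoves hJ hx) with h | ⟨i, l, h⟩ <;> cases h
      · intro J hJ x hx
        rcases of_mem_disputeMoves hJ hx with ⟨⟨n, h⟩, -⟩ | ⟨a', s₁, b', s₂, c', h, h₁, h₂, rfl⟩
        -- An unlabelled dispute needs a valid witness with equal lengths, which honest labels
        -- exclude.
        · exact absurd rfl ((occurs_frame_iff.1 h).of_isCount hs).1
        · obtain ⟨hne, hl₁, hl₂⟩ := (occurs_frame_iff.1 h).of_isCount hs
          have h2 : ∀ {s : List (Option Bool)}, (∃ t, s = none :: none :: t) → 2 ≤ s.length := by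
            rintro _ ⟨t, rfl⟩
            simp
          obtain ⟨k', rfl, hk₁⟩ := ht (h2 h₁) (hl₁.trans hl)
          obtain ⟨k'', hk'', hk₂⟩ := ht (h2 h₂) (hl₂.trans hl)
          obtain rfl := Nat.succ_injective hk''
          -- The opponent's claim is false, so the second half applies one level lower.
          exact (ih k' (Nat.lt_succ_self _)).2 a' s₁ b' s₂ c' h₁ h₂ hne hk₁ hk₂
    · intro a s b s' c hs hs' hne hl hl'
      -- The answer to a false claim is a true objection; honest labels on it lead to the first half
      -- one level lower.
      obtain ⟨n, hn, h⟩ := exists_dispute hs hs' hne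
      replace hn : 2 ^ n ≤ tower k := hn.elim (·.trans hl) (·.trans hl')
      obtain ⟨J, hJ, hx | ⟨a', t, b', c', htc, rfl, h2, hx⟩⟩ :=
        exists_mem_disputeMoves (occurs_frame_iff.2 h)
      · exact AARM.Forces.of_move (M := machine α e) (Or.inr (Or.inr hJ)) hx (forces_dead hG _ _)
      · obtain ⟨k', rfl, hk⟩ := ht h2 hn
        exact AARM.Forces.of_move (M := machine α e) (Or.inr (Or.inr hJ)) hx
          ((ih k' (Nat.lt_succ_self _)).1 a' t b' c' htc hk)

/-- The player who may dispute the equality of two different words in the input wins. -/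
theorem forces_input_of_ne (hG : G p.other) (hp : inputMoves α e p = disputeMoves (inputPatterns α))
    {w : List (PadSym α)} {u v : List α} (h : Encodes w u v) (huv : u ≠ v) {k : ℕ}
    (hk : w.length ≤ tower k) : (machine α e).Forces p G (k + 3) p (w.map input) := by
  obtain ⟨n, hn, h⟩ := exists_occurs_of_encodes h huv
  obtain ⟨J, hJ, hx | ⟨a', t, b', c', htc, rfl, h2, hx⟩⟩ := exists_mem_disputeMoves h
  · exact AARM.Forces.of_move (M := machine α e) (Or.inl (hp ▸ hJ)) hx (forces_dead hG _ _)
  · exact AARM.Forces.of_move (M := machine α e) (Or.inl (hp ▸ hJ)) hx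
      ((forces_frame hG k).1 a' t b' c' htc (hn.trans hk))

/-- The opponent of the player who may dispute the equality of two words in the input wins if there
is no difference. -/
theorem forces_input_of_eq (hG : G p.other)
    (hp : inputMoves α e p.other = disputeMoves (inputPatterns α))
    {w : List (PadSym α)} (h : ∀ u v, Encodes w u v → u = v) {k : ℕ}
    (hk : w.length ≤ tower k) : (machine α e).Forces p G (k + 3) p.other (w.map input) := by
  refine forces_of_forall hG ?_ ?_ ?_
  · intro x hx
    obtain ⟨a, rfl⟩ := mem_map_input hx
    simp
  · intro J hJ x hx
    rw [hp] at hJ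
    have key : ∀ {p q : ℕ}, Occurs (inputPatterns α) (w.map input) p q →
        p ≠ q ∧ p ≤ w.length ∧ q ≤ w.length := by
      intro p q hpq
      obtain ⟨P, b, Q, b', hw, hb, rfl, rfl⟩ := exists_encodes_of_occurs hpq
      -- Both words are equal, so prefixes of the same length leave the same remainder, with the
      -- same first letter.
      refine ⟨fun hl => hb (by rw [(List.append_inj (h _ _ hw) hl).2]), ?_⟩
      obtain ⟨a, b, c, d, rfl⟩ := hw
      simp only [List.length_append, List.length_map]
      omega
    rcases of_mem_disputeMoves hJ hx with ⟨⟨n, h⟩, -⟩ | ⟨a', s₁, b', s₂, c', h, h₁, h₂, rfl⟩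
    · exact absurd rfl (key h).1
    · obtain ⟨hne, hl₁, hl₂⟩ := key h
      exact (forces_frame hG k).2 a' s₁ b' s₂ c' h₁ h₂ hne (hl₁.trans hk) (hl₂.trans hk)
  · intro J hJ x hx
    obtain ⟨i, l, h⟩ := exists_seg_mem_of_mem_disputeMoves hJ hx
    obtain ⟨a, h⟩ := mem_map_input h
    cases h

/-- If the two words in the input are not equal, then Boris wins when Anke claims that they are. -/
theorem forces_boris_of_ne (hG : G .anke) {w : List (PadSym α)}
    (h : ∀ u v, Encodes w u v → u ≠ v) {k : ℕ} (hk : w.length ≤ tower k) :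
    (machine α true).Forces .boris G (k + 4) .anke (w.map input) := by
  refine forces_of_forall (p := .boris) hG ?_ ?_ ?_
  · intro x hx
    obtain ⟨a, rfl⟩ := mem_map_input hx
    simp
  · intro J hJ x hx
    obtain rfl := Set.mem_singleton_iff.1 hJ
    obtain ⟨hw, rfl : w.map input = x⟩ := hx
    obtain ⟨u, v, hw⟩ := map_input_mem_formatL.1 hw
    exact forces_input_of_ne hG rfl hw (h u v hw) hk
  · intro J hJ x hx
    obtain ⟨i, l, h⟩ := exists_seg_mem_of_mem_disputeMoves hJ hx
    obtain ⟨a, h⟩ := mem_map_input h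
    cases h

/-- If the two words in the input are equal, then Anke wins when she claims that they are. -/
theorem forces_anke_of_eq (hG : G .boris) {w : List (PadSym α)} {u : List α} (h : Encodes w u u)
    {k : ℕ} (hk : w.length ≤ tower k) :
    (machine α true).Forces .anke G (k + 4) .anke (w.map input) := by
  have hw : w.map input ∈ formatL α := map_input_mem_formatL.2 ⟨u, u, h⟩
  refine AARM.Forces.of_move (M := machine α true) (p := .anke) (Or.inl rfl)
    (x := w.map input) ⟨hw, rfl⟩ ?_
  refine forces_input_of_eq (p := .anke) hG rfl (fun u' v' h' => ?_) hk
  exact (h'.unique h).1.trans (h'.unique h).2.symm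

/-- A player can end the game by resigning. -/
theorem forces_end_of_live {r : List (Reg α)} (hr : ∃ a t, r = a :: t ∧ a.Live) :
    (machine α e).Forces p (fun _ => True) 2 p r := by
  refine AARM.Forces.of_move (M := machine α e) (Or.inr (Or.inl (Or.inl rfl)))
    (mem_resignMove.2 ⟨hr, rfl⟩) (AARM.Forces.of_forall trivial fun J hJ x hx => ?_)
  obtain ⟨-, rfl⟩ := eq_dead_of_mem_moves hJ
    (fun a ha => Or.inl (List.eq_of_mem_replicate ha)) hx
  exact forces_dead trivial _ _

theorem forces_end_of_mem_disputeMoves {S : Set (Pattern (Reg α))}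
    {J : Set (List (Reg α) × List (Reg α))} (hJ : J ∈ disputeMoves S) {r x : List (Reg α)}
    (hx : (r, x) ∈ J) : (machine α e).Forces p (fun _ => True) 2 p x := by
  rcases of_mem_disputeMoves hJ hx with ⟨-, rfl⟩ | ⟨a, s, b, s', c, -, ⟨t, rfl⟩, -, rfl⟩
  · exact forces_dead trivial _ _
  · refine forces_end_of_live ?_
    obtain ⟨x, u, hu⟩ := List.exists_cons_of_ne_nil
      (l := (frame a (none :: none :: t) b s' c : List (Reg α))) (by simp [frame])
    refine ⟨x, u, hu, ?_⟩
    rcases mem_frame (hu ▸ List.mem_cons_self) with rfl | ⟨i, l, rfl⟩ <;> simp [Live]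

/-- Each player can enforce that the game ends soon. -/
theorem forces_end (p : Player) (w : List (PadSym α)) :
    (machine α e).Forces p (fun _ => True) 3 .anke (w.map input) := by
  cases w with
  | nil => exact forces_dead (α := α) trivial 0 3
  | cons a w =>
    have hlive : ∃ b t, (a :: w).map input = b :: t ∧ b.Live :=
      ⟨input a, w.map input, rfl, by simp [Live]⟩
    -- Anke can resign at once; Boris has to sit through one turn of Anke before he can.
    cases p
    · exact AARM.Forces.succ (forces_end_of_live hlive)
    · refine forces_of_forall (p := .boris) trivial ?_ ?_ ?_
      · intro x hx
        obtain ⟨b, rfl⟩ := mem_map_input hx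
        simp
      · intro J hJ x hx
        cases e
        · exact forces_end_of_mem_disputeMoves (S := inputPatterns α) hJ hx
        · obtain rfl := Set.mem_singleton_iff.1 hJ
          obtain ⟨-, rfl : (a :: w).map input = x⟩ := hx
          exact forces_end_of_live hlive
      · intro J hJ x hx
        exact forces_end_of_mem_disputeMoves hJ hx

theorem eqLanguage_decides :
    (machine α true).Decides (eqLanguage α) (fun n => logStar n + 4) := by
  intro w
  have hk := le_tower_logStar w.length
  refine ⟨fun p => ((forces_end p w).mono (Nat.le_add_left 3 (_ + 1))).forcesEnd, ?_⟩
  by_cases hw : w ∈ eqLanguage α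
  · obtain ⟨u, _, h, rfl⟩ := mem_eqLanguage.1 hw
    exact ⟨.anke, (forces_anke_of_eq (G := (· = Player.boris)) rfl h hk).winsWithin,
      iff_of_true hw rfl⟩
  · refine ⟨.boris, (forces_boris_of_ne (G := (· = Player.anke)) rfl (fun u v h huv =>
      hw (mem_eqLanguage.2 ⟨u, v, h, huv⟩)) hk).winsWithin, iff_of_false hw (by simp)⟩

theorem neLanguage_decides :
    (machine α false).Decides (neLanguage α) (fun n => logStar n + 4) := by
  intro w
  have hk := le_tower_logStar w.length
  refine ⟨fun p => ((forces_end p w).mono (Nat.le_add_left 3 (_ + 1))).forcesEnd, ?_⟩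
  by_cases hw : w ∈ neLanguage α
  · obtain ⟨u, v, h, huv⟩ := mem_neLanguage.1 hw
    exact ⟨.anke, ((forces_input_of_ne (p := .anke) (G := (· = Player.boris)) rfl rfl h huv
      hk).mono (Nat.le_succ _)).winsWithin, iff_of_true hw rfl⟩
  · refine ⟨.boris, ((forces_input_of_eq (p := .boris) (G := (· = Player.anke)) rfl rfl
      (fun u v h => ?_) hk).mono (Nat.le_succ _)).winsWithin, iff_of_false hw (by simp)⟩
    by_contra huv
    exact hw (mem_neLanguage.2 ⟨u, v, h, huv⟩)

end Reg

theorem mainTheorem3 (α : Type u) [Finite α] :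
    eqLanguage α ∈ BAALLogStar (PadSym α) ∧ neLanguage α ∈ BAALLogStar (PadSym α) :=
  ⟨⟨4, _, Reg.eqLanguage_decides⟩, ⟨4, _, Reg.neLanguage_decides⟩⟩
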